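/- **Proposition (uniqueness of the solution of the mean-field response problem).** States are $\underline s=(E,\underline h)\in\mathbb R\times\mathbb R^2=\mathbb R^3$. Let $T\le T'$, $\eta\in\mathbb R$, $\underline\mu\in\mathbb R^2$, let $\hat r(t,\underline s,p,m)\in\mathbb R$ be an instantaneous reward (power level $p\in[0,P^{\max}]$, mean field $m$), and let $$\tilde H(t,\underline s,u',m)=\sup_{p\in[0,P^{\max}]}\{\hat r(t,\underline s,p,m)-p\,u'\}.$$ Here $\mathbb P$ denotes the set of continuous probability densities on $\mathbb R^3$ that decay faster than every polynomial. The functional derivatives $\partial_m\tilde H$ and $\partial^2_{mu'}\tilde H$ are the linear functionals with $\langle\partial_m F(m),m'-m\rangle=\lim_{\tau\to0^+}\frac{F(m+\tau(m'-m))-F(m)}{\tau}$ for all $m'\in\mathbb P$, applied to $F=\tilde H(t,\underline s,u',\cdot)$ and $F=\partial_{u'}\tilde H(t,\underline s,u',\cdot)$. Assume that, for each $t\in[T,T']$ and $m\in\mathbb P$, $\tilde H$ is measurable in $(\underline s,u')$, that it is $C^2$ in $u'$, that these functional derivatives exist, and that $\partial^2_{u'}\tilde H$, $\partial_m\tilde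 H$ and $\partial^2_{mu'}\tilde H$ are continuous in $(u',\lambda)$ along the segments $m_\lambda=m+\lambda(m'-m)$, $0\le\lambda\le1$ (the latter two applied to $m'-m$), with at most polynomial growth in $(\underline s,u')$, uniformly in $\lambda$. Consider the system on $[T,T']\times\mathbb R^3$ $$\partial_t v_t+\tilde H(t,\underline s,\partial_E v_t,m_t)+\tfrac12\langle\underline\mu-\underline h,\nabla_{\underline h}v_t\rangle+\tfrac{\eta^2}{2}\Delta_{\underline h}v_t=0,\qquad v_{T'}=q,$$ $$\partial_t m_t+\partial_E\bigl(m_t\,\partial_{u'}\tilde H(t,\underline s,\partial_E v_t,m_t)\bigr)+\operatorname{div}_{\underline h}\bigl(m_t\tfrac12(\underline\mu-\underline h)\bigr)=\tfrac{\eta^2}{2}\Delta_{\underline h}m_t,\qquad m_T\ \text{given}.$$ A solution is a pair $(v,m)$ that satisfies it classically, with $m_t\in\mathbb P$ for all $t$, where $v$ and $m$ are differentiable in $t$, $C^1$ in $\underline s$ with $\nabla_{\underline h}$ again $C^1$ in $\underline s$, the flux $m_t\,\partial_{u'}\tilde H$ is differentiable in $E$, and where, uniformly in $t$, $v$ and its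 derivatives $\partial_t,\partial_E,\nabla_{\underline h},\partial_{h_i}^2$ ($i=1,2$) grow at most polynomially while $m$ and the same derivatives of $m$ decay faster than every polynomial. For $m\in\mathbb P$ and a profile $\underline s\mapsto u'(\underline s)$ (continuous, of at most polynomial growth) put $$(A_{11}x)(\underline s)=-\tfrac1{m(\underline s)}\langle\partial_m\tilde H(t,\underline s,u'(\underline s),m),x\rangle,\quad (A_{12}x)(\underline s)=\tfrac12\langle\partial^2_{mu'}\tilde H(t,\underline s,u'(\underline s),m),x\rangle,\quad a_{22}(\underline s)=\partial^2_{u'}\tilde H(t,\underline s,u'(\underline s),m).$$ An operator $O$ is called positive, $O\succ0$, if $\langle x,Ox\rangle_{L^2(m)}=\int x\,(Ox)\,m\,d\underline s>0$ for every $x\ne0$ of the form $x=m'-m$ with $m'\in\mathbb P$ vanishing wherever $m$ vanishes. Suppose that for all $t\in[T,T']$, all $m\in\mathbb P$ and all profiles $u'$ $$A_{11}=-\frac1m\frac{\partial\tilde H}{\partial m}\succ0,\qquad A_{11}-A_{12}^*\,a_{22}^{-1}A_{12}=-\frac1m\frac{\partial\tilde H}{\partial m}-\frac14\,\frac{\bigl(\partial^2\tilde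 H/\partial m\,\partial u'\bigr)^2}{\partial^2\tilde H/\partial u'^2}\succ0,$$ and $\partial^2\tilde H/\partial u'^2(t,\underline s,u',m)>0$ for all $t\in[T,T']$ and $(\underline s,u',m)\in\mathbb R^3\times\mathbb R\times\mathbb P$. Here the form of the second operator is $\int\bigl(x\,A_{11}x-(A_{12}x)^2/a_{22}\bigr)m\,d\underline s$, which is required to converge. Then the system has at most one solution: if $(v_1,m_1)$ and $(v_2,m_2)$ are solutions with the same $q$ and the same $m_T$, then $v_{1,t}=v_{2,t}$ and $m_{1,t}=m_{2,t}$ for all $t\in[T,T']$. -/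

import Mathlib

open Set Filter Topology MeasureTheory

noncomputable section

namespace MeanField

/-- The individual state `s = (E, h)`: coordinate `0` is the energy `E`, coordinates `1, 2` are
the channel vector `h`. -/
abbrev State : Type := EuclideanSpace ℝ (Fin 3)

/-- The partial derivative `∂ᵢ f` with respect to the `i`-th coordinate of the state. -/
def pd (i : Fin 3) (f : State → ℝ) (s : State) : ℝ :=
  lineDeriv ℝ f s (EuclideanSpace.single i (1 : ℝ))

/-- The Laplacian with respect to the channel variable `h`. -/
def lapH (f : State → ℝ) (s : State) : ℝ := pd 1 (pd 1 f) s + pd 2 (pd 2 f) s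

/-- `⟨μ - h, ∇_h f⟩`. -/
def driftH (μ : Fin 2 → ℝ) (f : State → ℝ) (s : State) : ℝ :=
  (μ 0 - s 1) * pd 1 f s + (μ 1 - s 2) * pd 2 f s

/-- `div_h (f · (μ - h) / 2)`. -/
def divDriftH (μ : Fin 2 → ℝ) (f : State → ℝ) (s : State) : ℝ :=
  pd 1 (fun z => f z * ((1 / 2) * (μ 0 - z 1))) s
    + pd 2 (fun z => f z * ((1 / 2) * (μ 1 - z 2))) s

/-- The time derivative on the horizon `[T, T']` (one-sided at the end points). -/
def timeDeriv (T T' : ℝ) (f : ℝ → State → ℝ) (t : ℝ) (s : State) : ℝ :=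
  derivWithin (fun τ => f τ s) (Icc T T') t

/-! ### Growth and decay -/

/-- At most polynomial growth in the state, uniformly in time on `[T, T']`. -/
def PolyGrowth (T T' : ℝ) (f : ℝ → State → ℝ) : Prop :=
  ∃ (C : ℝ) (k : ℕ), ∀ t ∈ Icc T T', ∀ s, |f t s| ≤ C * (1 + ‖s‖) ^ k

/-- Decay faster than every polynomial in the state, uniformly in time on `[T, T']`. -/
def RapidDecay (T T' : ℝ) (f : ℝ → State → ℝ) : Prop :=
  ∀ k : ℕ, ∃ C : ℝ, ∀ t ∈ Icc T T', ∀ s, (1 + ‖s‖) ^ k * |f t s| ≤ C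

/-- `f` is of class `C¹` in time and state, with `∇_h f` again of class `C¹` in the state, and
`f`, `∂ₜ f`, `∂ᵢ f` and the second derivatives in `h` that occur in `Δ_h f` all obey the growth
condition `G`. -/
structure IsC12 (T T' : ℝ) (G : (ℝ → State → ℝ) → Prop) (f : ℝ → State → ℝ) : Prop where
  diff_time : ∀ t ∈ Icc T T', ∀ s, DifferentiableWithinAt ℝ (fun τ => f τ s) (Icc T T') t
  diff_state : ∀ t ∈ Icc T T', ContDiff ℝ 1 (f t)
  diff_state_one : ∀ t ∈ Icc T T', ContDiff ℝ 1 (pd 1 (f t))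
  diff_state_two : ∀ t ∈ Icc T T', ContDiff ℝ 1 (pd 2 (f t))
  growth : G f
  growth_time : G (timeDeriv T T' f)
  growth_state : ∀ i, G (fun t => pd i (f t))
  growth_one_one : G (fun t => pd 1 (pd 1 (f t)))
  growth_two_two : G (fun t => pd 2 (pd 2 (f t)))

/-! ### Mean fields and functional derivatives -/

/-- Continuous probability densities on the state space that decay faster than every polynomial. -/
structure IsDensity (m : State → ℝ) : Prop where
  cont : Continuous m
  nonneg : ∀ s, 0 ≤ m s
  decay : ∀ k : ℕ, ∃ C : ℝ, ∀ s, (1 + ‖s‖) ^ k * |m s| ≤ C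
  mass : ∫ s, m s = 1

/-- `L` is the functional derivative of `F` at the mean field `m`: for every mean field `m'`,
`⟨L, m' - m⟩ = lim_{τ → 0} (F (m + τ (m' - m)) - F m) / τ`. Only `τ > 0` is used, so that
`m + τ (m' - m)` is a mean field. -/
def IsFunctionalDeriv (F : (State → ℝ) → ℝ) (m : State → ℝ) (L : (State → ℝ) →ₗ[ℝ] ℝ) : Prop :=
  ∀ m', IsDensity m' →
    Tendsto (fun τ : ℝ => (F (m + τ • (m' - m)) - F m) / τ) (𝓝[>] 0) (𝓝 (L (m' - m)))

/-! ### The Hamiltonian -/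

/-- `H̃(s, u', m) = sup_p { r̂(s, p, m) - p u' }`, the supremum being over the power levels
`p ∈ [0, Pmax]`. -/
def hamiltonian (Pmax : ℝ) (r : State → ℝ → (State → ℝ) → ℝ)
    (s : State) (u : ℝ) (m : State → ℝ) : ℝ :=
  sSup ((fun p => r s p m - p * u) '' Icc 0 Pmax)

/-- `∂H̃/∂u'`. -/
def derivU (H : State → ℝ → (State → ℝ) → ℝ) (s : State) (u : ℝ) (m : State → ℝ) : ℝ :=
  deriv (fun u' => H s u' m) u

/-- `∂²H̃/∂u'²`. -/
def derivUU (H : State → ℝ → (State → ℝ) → ℝ) (s : State) (u : ℝ) (m : State → ℝ) : ℝ :=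
  deriv (fun u' => derivU H s u' m) u

/-- The standing regularity of a Hamiltonian: it is measurable in `(s, u')`, of class `C²` in
`(u', m)` with functional derivatives `Hm = ∂H̃/∂m` and `Hum = ∂²H̃/∂m∂u'`, the derivatives being
continuous along segments of mean fields and of at most polynomial growth in `(s, u')`. -/
structure RegularHamiltonian (H : State → ℝ → (State → ℝ) → ℝ)
    (Hm Hum : State → ℝ → (State → ℝ) → ((State → ℝ) →ₗ[ℝ] ℝ)) : Prop where
  meas : ∀ m, IsDensity m → Measurable (fun z : State × ℝ => H z.1 z.2 m)
  diff_u : ∀ s m, IsDensity m → ContDiff ℝ 2 (fun u => H s u m)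
  diff_m : ∀ s u m, IsDensity m → IsFunctionalDeriv (fun n => H s u n) m (Hm s u m)
  diff_um : ∀ s u m, IsDensity m → IsFunctionalDeriv (fun n => derivU H s u n) m (Hum s u m)
  cont_uu : ∀ s m m', IsDensity m → IsDensity m' →
    ContinuousOn (fun z : ℝ × ℝ => derivUU H s z.1 (m + z.2 • (m' - m))) (univ ×ˢ Icc 0 1)
  cont_m : ∀ s m m', IsDensity m → IsDensity m' →
    ContinuousOn (fun z : ℝ × ℝ => Hm s z.1 (m + z.2 • (m' - m)) (m' - m)) (univ ×ˢ Icc 0 1)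
  cont_um : ∀ s m m', IsDensity m → IsDensity m' →
    ContinuousOn (fun z : ℝ × ℝ => Hum s z.1 (m + z.2 • (m' - m)) (m' - m)) (univ ×ˢ Icc 0 1)
  growth : ∀ m m', IsDensity m → IsDensity m' → ∃ (C : ℝ) (k : ℕ),
    ∀ (s : State) (u : ℝ), ∀ lam ∈ Icc (0 : ℝ) 1,
      |derivUU H s u (m + lam • (m' - m))| ≤ C * (1 + ‖s‖ + |u|) ^ k ∧
      |Hm s u (m + lam • (m' - m)) (m' - m)| ≤ C * (1 + ‖s‖ + |u|) ^ k ∧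
      |Hum s u (m + lam • (m' - m)) (m' - m)| ≤ C * (1 + ‖s‖ + |u|) ^ k

/-! ### Positive operators -/

/-- A profile `s ↦ u'(s)` of the variable `u'`: continuous, of at most polynomial growth. -/
def IsProfile (u : State → ℝ) : Prop :=
  Continuous u ∧ ∃ (C : ℝ) (k : ℕ), ∀ s, |u s| ≤ C * (1 + ‖s‖) ^ k

/-- The directions `x = m' - m` in which mean fields can vary at `m`, as elements of `L²(m)`:
`m'` is a mean field that vanishes wherever `m` does. -/
def IsDirection (m x : State → ℝ) : Prop :=
  ∃ m', IsDensity m' ∧ (∀ s, m s = 0 → m' s = 0) ∧ x = m' - m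

/-- The quadratic form `x ↦ ⟨x, O x⟩` of an operator is positive: `⟨x, O x⟩ > 0` for every
direction `x ≠ 0`. -/
def PositiveForm (m : State → ℝ) (Q : (State → ℝ) → ℝ) : Prop :=
  ∀ x, IsDirection m x → x ≠ 0 → 0 < Q x

/-- The operator `-(1/m) ∂H̃/∂m` at the mean field `m` and the profile `u` of `u'`:
it maps `x` to the function `s ↦ -(1/m(s)) ⟨∂H̃/∂m (s, u(s), m), x⟩`. -/
def opM (Hm : State → ℝ → (State → ℝ) → ((State → ℝ) →ₗ[ℝ] ℝ)) (u m x : State → ℝ)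
    (s : State) : ℝ :=
  -(1 / m s) * Hm s (u s) m x

/-- The operator `∂²H̃/∂m∂u'` at the mean field `m` and the profile `u` of `u'`:
it maps `x` to the function `s ↦ ⟨∂²H̃/∂m∂u' (s, u(s), m), x⟩`. -/
def opUM (Hum : State → ℝ → (State → ℝ) → ((State → ℝ) →ₗ[ℝ] ℝ)) (u m x : State → ℝ)
    (s : State) : ℝ :=
  Hum s (u s) m x

/-- The quadratic form of `-(1/m) ∂H̃/∂m` in `L²(m)`. -/
def formM (Hm : State → ℝ → (State → ℝ) → ((State → ℝ) →ₗ[ℝ] ℝ)) (u m x : State → ℝ) : ℝ :=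
  ∫ s, (x s * opM Hm u m x s) * m s

/-- The quadratic form in `L²(m)` of the Schur complement `A₁₁ - A₁₂* a₂₂⁻¹ A₁₂`, where
`A₁₁ = -(1/m) ∂H̃/∂m`, `A₁₂ = (1/2) ∂²H̃/∂m∂u'` and `a₂₂ = ∂²H̃/∂u'²`. -/
def formSchur (H : State → ℝ → (State → ℝ) → ℝ)
    (Hm Hum : State → ℝ → (State → ℝ) → ((State → ℝ) →ₗ[ℝ] ℝ)) (u m x : State → ℝ) : ℝ :=
  ∫ s, (x s * opM Hm u m x s
      - ((1 / 2) * opUM Hum u m x s) ^ 2 / derivUU H s (u s) m) * m s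

/-! ### The mean-field response problem -/

/-- `(v, m)` is a (classical) solution on `[T, T']` of the mean-field response problem with reward
`r`, final utility `q` and initial mean field `m₀`. -/
structure IsSolution (T T' Pmax η : ℝ) (μ : Fin 2 → ℝ)
    (r : ℝ → State → ℝ → (State → ℝ) → ℝ) (q m₀ : State → ℝ)
    (v m : ℝ → State → ℝ) : Prop where
  v_reg : IsC12 T T' (PolyGrowth T T') v
  m_reg : IsC12 T T' (RapidDecay T T') m
  density : ∀ t ∈ Icc T T', IsDensity (m t)
  flux_diff : ∀ t ∈ Icc T T', ∀ s, LineDifferentiableAt ℝ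
    (fun z => m t z * derivU (hamiltonian Pmax (r t)) z (pd 0 (v t) z) (m t)) s
    (EuclideanSpace.single 0 (1 : ℝ))
  hjb : ∀ t ∈ Icc T T', ∀ s,
    timeDeriv T T' v t s + hamiltonian Pmax (r t) s (pd 0 (v t) s) (m t)
      + (1 / 2) * driftH μ (v t) s + η ^ 2 / 2 * lapH (v t) s = 0
  fpk : ∀ t ∈ Icc T T', ∀ s,
    timeDeriv T T' m t s
      + pd 0 (fun z => m t z * derivU (hamiltonian Pmax (r t)) z (pd 0 (v t) z) (m t)) s
      + divDriftH μ (m t) s = η ^ 2 / 2 * lapH (m t) s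
  final : v T' = q
  initial : m T = m₀

end MeanField

end

/-!
Write `w = v₂ - v₁` and `x = m₂ - m₁` for the differences of two solutions. The proof rests on the
duality pairing `g t = ∫ w x`, which vanishes at both ends of the horizon because the solutions
share `q` and `m_T`.

The drift and diffusion parts of the two equations are adjoint to each other, so they drop out of
`g'` after integration by parts (`integral_timeDeriv_eq`), which leaves
`∫ (y (m₂ ∂_{u'}H̃₂ - m₁ ∂_{u'}H̃₁) - (H̃₂ - H̃₁) x)` with `y = ∂_E w`. This is the increment from
`λ = 0` to `λ = 1` of the integral of `pathIntegrand`, the same expression along the segment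
`(u_λ, m_λ)` between the two solutions. Its derivative in `λ` is the quadratic form of the block
operator `(A₁₁, A₁₂; A₁₂*, a₂₂)` at `(x, y)`, and completing the square in `y` bounds it below by
the form of the Schur complement (`schur_le_pathDeriv`). Here `x` is, up to the factor `1 - λ`, the
direction `m₂ - m_λ` at `m_λ`. Hence `g' ≥ 0`, with strict inequality unless `x = 0`
(`integral_path_pos`). As `g` is nondecreasing and zero at both ends, `g' = 0` and `m₁ = m₂`
(`IsSolution.density_eq`).

The form carries no information on `y` where the density vanishes, so the equality of the values
comes from the maximum principle. The Hamiltonian is a supremum of affine functions of `u'` with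
slopes in `[-Pmax, 0]`, hence Lipschitz in `u'`; with a common mean field, `w` and `-w` are
subsolutions of a linear equation with bounded coefficient in front of `|∂_E w|`, and the barrier
`e^{K (T' - t)} (1 + ‖s‖²)^{k+2}` dominates their polynomial growth (`nonpos_of_subsolution`).

The assumptions give no bound on `H̃` itself: the bound `|∂_{u'}H̃| ≤ |Pmax|`, and the equations for
`H̃` and for the `E`-derivative of the flux, supply the growth and decay that the integrations need.
-/

noncomputable section

namespace MeanField

/-! ### Uniform growth and decay -/

variable {ι : Type*}

/-- At most polynomial growth in the state, uniformly over the indices in `S`. For `S = Icc T T'`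
this is `PolyGrowth T T'`. -/
def PolyOn (S : Set ι) (f : ι → State → ℝ) : Prop :=
  ∃ (C : ℝ) (k : ℕ), ∀ i ∈ S, ∀ s, |f i s| ≤ C * (1 + ‖s‖) ^ k

/-- Decay faster than every polynomial, uniformly over the indices in `S`. For `S = Icc T T'`
this is `RapidDecay T T'`. -/
def RapidOn (S : Set ι) (f : ι → State → ℝ) : Prop :=
  ∀ k : ℕ, ∃ C : ℝ, ∀ i ∈ S, ∀ s, (1 + ‖s‖) ^ k * |f i s| ≤ C

variable {S : Set ι} {f g : ι → State → ℝ}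

theorem one_le_one_add_norm (s : State) : 1 ≤ 1 + ‖s‖ := by linarith [norm_nonneg s]

theorem PolyOn.exists_nonneg (hf : PolyOn S f) :
    ∃ (C : ℝ) (k : ℕ), 0 ≤ C ∧ ∀ i ∈ S, ∀ s, |f i s| ≤ C * (1 + ‖s‖) ^ k := by
  obtain ⟨C, k, h⟩ := hf
  refine ⟨|C|, k, abs_nonneg C, fun i hi s => (h i hi s).trans ?_⟩
  have := one_le_one_add_norm s
  gcongr
  exact le_abs_self C

theorem PolyOn.mono_abs (hg : PolyOn S g) (h : ∀ i ∈ S, ∀ s, |f i s| ≤ |g i s|) :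
    PolyOn S f := by
  obtain ⟨C, k, hC⟩ := hg
  exact ⟨C, k, fun i hi s => (h i hi s).trans (hC i hi s)⟩

theorem PolyOn.congr (hg : PolyOn S g) (h : ∀ i ∈ S, ∀ s, f i s = g i s) : PolyOn S f :=
  hg.mono_abs fun i hi s => by rw [h i hi s]

theorem PolyOn.fix {κ : Type*} (hf : PolyOn S f) {i : ι} (hi : i ∈ S) (S' : Set κ) :
    PolyOn S' (fun _ => f i) := by
  obtain ⟨C, k, h⟩ := hf
  exact ⟨C, k, fun _ _ s => h i hi s⟩

theorem PolyOn.add (hf : PolyOn S f) (hg : PolyOn S g) :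
    PolyOn S (fun i s => f i s + g i s) := by
  obtain ⟨C, k, hC, h⟩ := hf.exists_nonneg
  obtain ⟨D, l, hD, h'⟩ := hg.exists_nonneg
  refine ⟨C + D, k + l, fun i hi s => ?_⟩
  have h1 := one_le_one_add_norm s
  have e1 : (1 + ‖s‖) ^ k ≤ (1 + ‖s‖) ^ (k + l) := pow_le_pow_right₀ h1 (by omega)
  have e2 : (1 + ‖s‖) ^ l ≤ (1 + ‖s‖) ^ (k + l) := pow_le_pow_right₀ h1 (by omega)
  calc |f i s + g i s| ≤ |f i s| + |g i s| := abs_add_le _ _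
    _ ≤ C * (1 + ‖s‖) ^ k + D * (1 + ‖s‖) ^ l := add_le_add (h i hi s) (h' i hi s)
    _ ≤ C * (1 + ‖s‖) ^ (k + l) + D * (1 + ‖s‖) ^ (k + l) := by gcongr
    _ = _ := by ring

theorem PolyOn.mul (hf : PolyOn S f) (hg : PolyOn S g) :
    PolyOn S (fun i s => f i s * g i s) := by
  obtain ⟨C, k, hC, h⟩ := hf.exists_nonneg
  obtain ⟨D, l, hD, h'⟩ := hg.exists_nonneg
  refine ⟨C * D, k + l, fun i hi s => ?_⟩
  have h1 := one_le_one_add_norm s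
  calc |f i s * g i s| = |f i s| * |g i s| := abs_mul _ _
    _ ≤ (C * (1 + ‖s‖) ^ k) * (D * (1 + ‖s‖) ^ l) := by
      gcongr
      · exact h i hi s
      · exact h' i hi s
    _ = _ := by ring

theorem PolyOn.const (c : ℝ) : PolyOn S (fun _ _ => c) :=
  ⟨|c|, 0, fun _ _ _ => by simp⟩

theorem PolyOn.const_mul (c : ℝ) (hf : PolyOn S f) : PolyOn S (fun i s => c * f i s) :=
  (PolyOn.const c).mul hf

theorem PolyOn.neg (hf : PolyOn S f) : PolyOn S (fun i s => - f i s) :=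
  hf.mono_abs fun _ _ _ => by simp

theorem PolyOn.sub (hf : PolyOn S f) (hg : PolyOn S g) :
    PolyOn S (fun i s => f i s - g i s) := by
  simpa only [sub_eq_add_neg] using hf.add hg.neg

theorem abs_coord_le (s : State) (i : Fin 3) : |s i| ≤ ‖s‖ := by
  simpa using PiLp.norm_apply_le s i

theorem PolyOn.coord (j : Fin 3) : PolyOn S (fun _ s => s j) :=
  ⟨1, 1, fun _ _ s => by
    have := abs_coord_le s j
    have := one_le_one_add_norm s
    simp only [pow_one, one_mul]
    linarith⟩

theorem RapidOn.mono_abs (hg : RapidOn S g) (h : ∀ i ∈ S, ∀ s, |f i s| ≤ |g i s|) :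
    RapidOn S f := by
  intro k
  obtain ⟨C, hC⟩ := hg k
  refine ⟨C, fun i hi s => le_trans ?_ (hC i hi s)⟩
  exact mul_le_mul_of_nonneg_left (h i hi s) (by positivity)

theorem RapidOn.congr (hg : RapidOn S g) (h : ∀ i ∈ S, ∀ s, f i s = g i s) : RapidOn S f :=
  hg.mono_abs fun i hi s => by rw [h i hi s]

theorem RapidOn.fix {κ : Type*} (hf : RapidOn S f) {i : ι} (hi : i ∈ S) (S' : Set κ) :
    RapidOn S' (fun _ => f i) := by
  intro k
  obtain ⟨C, h⟩ := hf k
  exact ⟨C, fun _ _ s => h i hi s⟩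

theorem RapidOn.add (hf : RapidOn S f) (hg : RapidOn S g) :
    RapidOn S (fun i s => f i s + g i s) := by
  intro k
  obtain ⟨C, h⟩ := hf k
  obtain ⟨D, h'⟩ := hg k
  refine ⟨C + D, fun i hi s => ?_⟩
  have h1 := one_le_one_add_norm s
  calc (1 + ‖s‖) ^ k * |f i s + g i s| ≤ (1 + ‖s‖) ^ k * (|f i s| + |g i s|) := by
        gcongr
        exact abs_add_le _ _
    _ = (1 + ‖s‖) ^ k * |f i s| + (1 + ‖s‖) ^ k * |g i s| := by ring
    _ ≤ C + D := add_le_add (h i hi s) (h' i hi s)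

theorem RapidOn.mul_poly (hf : RapidOn S f) (hg : PolyOn S g) :
    RapidOn S (fun i s => f i s * g i s) := by
  intro k
  obtain ⟨D, l, hD, h'⟩ := hg.exists_nonneg
  obtain ⟨C, h⟩ := hf (k + l)
  refine ⟨C * D, fun i hi s => ?_⟩
  have h1 := one_le_one_add_norm s
  calc (1 + ‖s‖) ^ k * |f i s * g i s| = (1 + ‖s‖) ^ k * |f i s| * |g i s| := by
        rw [abs_mul, mul_assoc]
    _ ≤ (1 + ‖s‖) ^ k * |f i s| * (D * (1 + ‖s‖) ^ l) := by
        gcongr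
        exact h' i hi s
    _ = ((1 + ‖s‖) ^ (k + l) * |f i s|) * D := by ring
    _ ≤ C * D := by
        gcongr
        exact h i hi s

theorem PolyOn.mul_rapid (hf : PolyOn S f) (hg : RapidOn S g) :
    RapidOn S (fun i s => f i s * g i s) := by
  simpa only [mul_comm] using hg.mul_poly hf

theorem RapidOn.neg (hf : RapidOn S f) : RapidOn S (fun i s => - f i s) :=
  hf.mono_abs fun _ _ _ => by simp

theorem RapidOn.sub (hf : RapidOn S f) (hg : RapidOn S g) :
    RapidOn S (fun i s => f i s - g i s) := by
  simpa only [sub_eq_add_neg] using hf.add hg.neg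

theorem integrable_one_add_norm_rpow :
    Integrable (fun s : State => (1 + ‖s‖) ^ (-4 : ℝ)) :=
  integrable_one_add_norm (by simp; norm_num)

theorem RapidOn.exists_bound (hf : RapidOn S f) :
    ∃ C : ℝ, 0 ≤ C ∧ ∀ i ∈ S, ∀ s, |f i s| ≤ C * (1 + ‖s‖) ^ (-4 : ℝ) := by
  obtain ⟨C, h⟩ := hf 4
  refine ⟨|C|, abs_nonneg _, fun i hi s => ?_⟩
  have h1 : 0 < 1 + ‖s‖ := by linarith [one_le_one_add_norm s]
  rw [Real.rpow_neg h1.le, ← div_eq_mul_inv, le_div_iff₀ (by positivity), mul_comm]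
  have := h i hi s
  norm_cast
  exact this.trans (le_abs_self C)

theorem RapidOn.integrable (hf : RapidOn S f) {i : ι} (hi : i ∈ S)
    (hm : AEStronglyMeasurable (f i) volume) : Integrable (f i) := by
  obtain ⟨C, -, h⟩ := hf.exists_bound
  exact (integrable_one_add_norm_rpow.const_mul C).mono' hm
    (Eventually.of_forall fun s => by simpa using h i hi s)

/-- A pointwise derivative of measurable functions is measurable, being a limit of difference
quotients. -/
theorem measurable_of_hasDerivAt {α : Type*} [MeasurableSpace α] {F : ℝ → α → ℝ} {F' : α → ℝ}
    {t : ℝ} (hF : ∀ᶠ τ in 𝓝 t, Measurable (F τ))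
    (hd : ∀ a, HasDerivAt (fun τ => F τ a) (F' a) t) : Measurable F' := by
  have hlim : Tendsto (fun n : ℕ => t + 1 / ((n : ℝ) + 1)) atTop (𝓝 t) := by
    simpa using tendsto_const_nhds.add (tendsto_one_div_add_atTop_nhds_zero_nat (𝕜 := ℝ))
  have hne : Tendsto (fun n : ℕ => t + 1 / ((n : ℝ) + 1)) atTop (𝓝[≠] t) := by
    refine tendsto_nhdsWithin_iff.2 ⟨hlim, Eventually.of_forall fun n => ?_⟩
    have : (0 : ℝ) < 1 / ((n : ℝ) + 1) := by positivity
    simp only [mem_compl_iff, mem_singleton_iff]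
    linarith
  obtain ⟨N, hN⟩ := eventually_atTop.1 (hlim.eventually hF)
  refine measurable_of_tendsto_metrizable (f := fun n : ℕ => fun a =>
    slope (fun τ => F τ a) t (t + 1 / (((n + N : ℕ) : ℝ) + 1))) (fun n => ?_) ?_
  · simp only [slope_def_field]
    exact ((hN _ (by omega)).sub hF.self_of_nhds).div_const _
  · rw [tendsto_pi_nhds]
    intro a
    exact ((hasDerivAt_iff_tendsto_slope.1 (hd a)).comp hne).comp (tendsto_add_atTop_nat N)

/-- Differentiation under the integral sign for a family that decays rapidly together with its
derivative, with continuity up to the end points. -/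
theorem hasDerivAt_integral_of_rapid {a b : ℝ} {F F' : ℝ → State → ℝ}
    (hmeas : ∀ τ ∈ Icc a b, Measurable (F τ))
    (hFa : RapidOn (Icc a b) (fun _ => F a)) (hF' : RapidOn (Icc a b) F')
    (hc : ∀ s, ContinuousOn (fun τ => F τ s) (Icc a b))
    (hd : ∀ s, ∀ τ ∈ Ioo a b, HasDerivAt (fun σ => F σ s) (F' τ s) τ) :
    RapidOn (Icc a b) F ∧ ContinuousOn (fun τ => ∫ s, F τ s) (Icc a b) ∧
      ∀ τ ∈ Ioo a b, Integrable (F' τ) ∧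
        HasDerivAt (fun σ => ∫ s, F σ s) (∫ s, F' τ s) τ := by
  have hF : RapidOn (Icc a b) F := by
    intro k
    obtain ⟨C, hC⟩ := hFa k
    obtain ⟨D, hD⟩ := hF' k
    refine ⟨C + |D| * (b - a), fun τ hτ s => ?_⟩
    have h1 : 0 < (1 + ‖s‖) ^ k := by
      have := one_le_one_add_norm s
      positivity
    have hab : 0 ≤ b - a := by linarith [hτ.1, hτ.2]
    rcases eq_or_lt_of_le hτ.1 with rfl | haτ
    · have := hC a hτ s
      have : 0 ≤ |D| * (b - a) := by positivity
      linarith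
    obtain ⟨c, hc', hce⟩ := exists_hasDerivAt_eq_slope (fun τ => F τ s) (fun τ => F' τ s) haτ
      ((hc s).mono (Icc_subset_Icc_right hτ.2))
      (fun x hx => hd s x ⟨hx.1, hx.2.trans_le hτ.2⟩)
    have hcI : c ∈ Icc a b := ⟨hc'.1.le, hc'.2.le.trans hτ.2⟩
    have e : F τ s = F a s + F' c s * (τ - a) := by
      rw [hce, div_mul_cancel₀ _ (by linarith)]
      ring
    have hτb : |τ - a| ≤ b - a := by
      rw [abs_of_pos (by linarith)]
      linarith [hτ.2]
    calc (1 + ‖s‖) ^ k * |F τ s|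
        ≤ (1 + ‖s‖) ^ k * (|F a s| + |F' c s| * |τ - a|) := by
          rw [e, ← abs_mul]
          gcongr
          exact abs_add_le _ _
      _ = (1 + ‖s‖) ^ k * |F a s| + (1 + ‖s‖) ^ k * |F' c s| * |τ - a| := by ring
      _ ≤ C + |D| * (b - a) := by
          gcongr
          · exact hC τ hτ s
          · exact (hD c hcI s).trans (le_abs_self D)
  obtain ⟨C, -, hC⟩ := hF.exists_bound
  obtain ⟨D, -, hD⟩ := hF'.exists_bound
  refine ⟨hF, ?_, fun τ hτ => ?_⟩
  · refine continuousOn_of_dominated (bound := fun s => C * (1 + ‖s‖) ^ (-4 : ℝ))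
      (fun τ hτ => (hmeas τ hτ).aestronglyMeasurable)
      (fun τ hτ => Eventually.of_forall fun s => by simpa using hC τ hτ s)
      (integrable_one_add_norm_rpow.const_mul C) (Eventually.of_forall hc)
  · have hnhds : Ioo a b ∈ 𝓝 τ := Ioo_mem_nhds hτ.1 hτ.2
    have hmeas' : ∀ᶠ σ in 𝓝 τ, Measurable (F σ) := by
      filter_upwards [hnhds] with σ hσ using hmeas σ (Ioo_subset_Icc_self hσ)
    exact hasDerivAt_integral_of_dominated_loc_of_deriv_le
      (bound := fun s => D * (1 + ‖s‖) ^ (-4 : ℝ)) hnhds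
      (hmeas'.mono fun σ h => h.aestronglyMeasurable)
      (hF.integrable (Ioo_subset_Icc_self hτ)
        (hmeas τ (Ioo_subset_Icc_self hτ)).aestronglyMeasurable)
      (measurable_of_hasDerivAt hmeas' fun s => hd s τ hτ).aestronglyMeasurable
      (Eventually.of_forall fun s σ hσ => by simpa using hD σ (Ioo_subset_Icc_self hσ) s)
      (integrable_one_add_norm_rpow.const_mul D)
      (Eventually.of_forall fun s σ hσ => hd s σ hσ)

/-! ### Partial derivatives -/

/-- `f` has a partial derivative in the `i`-th coordinate at every state. -/
def PDiff (i : Fin 3) (f : State → ℝ) : Prop :=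
  ∀ s, LineDifferentiableAt ℝ f s (EuclideanSpace.single i (1 : ℝ))

section pd

variable {i : Fin 3} {p p' : State → ℝ}

theorem PDiff.hasDerivAt (hp : PDiff i p) (s : State) :
    HasDerivAt (fun τ : ℝ => p (s + τ • EuclideanSpace.single i (1 : ℝ))) (pd i p s) 0 :=
  (hp s).hasLineDerivAt

theorem PDiff.of_contDiff (hp : ContDiff ℝ 1 p) : PDiff i p := fun s =>
  ((hp.differentiable (by norm_num)) s).lineDifferentiableAt

theorem pd_eq_of_hasDerivAt {d : ℝ} {s : State}
    (h : HasDerivAt (fun τ : ℝ => p (s + τ • EuclideanSpace.single i (1 : ℝ))) d 0) :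
    pd i p s = d :=
  HasLineDerivAt.lineDeriv h

theorem continuous_pd (hp : ContDiff ℝ 1 p) : Continuous (pd i p) := by
  have h : pd i p = fun s => fderiv ℝ p s (EuclideanSpace.single i (1 : ℝ)) := by
    ext s
    exact ((hp.differentiable (by norm_num)) s).lineDeriv_eq_fderiv
  rw [h]
  exact (hp.continuous_fderiv (by norm_num)).clm_apply continuous_const

theorem measurable_pd (hp : PDiff i p) (hm : Measurable p) : Measurable (pd i p) :=
  measurable_of_hasDerivAt (Eventually.of_forall fun _ => hm.comp (by fun_prop)) hp.hasDerivAt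

theorem PDiff.sub (hp : PDiff i p) (hp' : PDiff i p') : PDiff i (fun s => p s - p' s) := fun s =>
  ((hp.hasDerivAt s).sub (hp'.hasDerivAt s)).differentiableAt

theorem pd_sub (hp : PDiff i p) (hp' : PDiff i p') (s : State) :
    pd i (fun z => p z - p' z) s = pd i p s - pd i p' s :=
  pd_eq_of_hasDerivAt ((hp.hasDerivAt s).sub (hp'.hasDerivAt s))

theorem PDiff.mul (hp : PDiff i p) (hp' : PDiff i p') : PDiff i (fun s => p s * p' s) := fun s =>
  ((hp.hasDerivAt s).mul (hp'.hasDerivAt s)).differentiableAt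

theorem pd_mul (hp : PDiff i p) (hp' : PDiff i p') (s : State) :
    pd i (fun z => p z * p' z) s = pd i p s * p' s + p s * pd i p' s := by
  have := pd_eq_of_hasDerivAt (p := fun z => p z * p' z)
    ((hp.hasDerivAt s).mul (hp'.hasDerivAt s))
  simpa using this

theorem integral_pd_eq_zero (hp : PDiff i p) (h : Integrable p) (h' : Integrable (pd i p)) :
    ∫ s, pd i p s = 0 := by
  have := integral_bilinear_hasLineDerivAt_right_eq_neg_left_of_integrable
    (μ := (volume : Measure State)) (f := fun _ : State => (1 : ℝ)) (f' := fun _ => (0 : ℝ))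
    (g := p) (g' := pd i p) (v := EuclideanSpace.single i (1 : ℝ))
    (B := ContinuousLinearMap.mul ℝ ℝ) (by simp) (by simpa using h') (by simpa using h)
    (fun s _ => hasDerivAt_const (0 : ℝ) (1 : ℝ)) (fun s _ => hp.hasDerivAt s)
  simpa using this

end pd

/-! ### The Hamiltonian as a function of `u'` -/

theorem hamiltonian_le_add (Pmax : ℝ) (r : State → ℝ → (State → ℝ) → ℝ) (s : State) (u u' : ℝ)
    (m : State → ℝ) :
    hamiltonian Pmax r s u m ≤ hamiltonian Pmax r s u' m + |Pmax| * |u - u'| := by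
  have key : ∀ a b : ℝ, ∀ p ∈ Icc 0 Pmax,
      r s p m - p * a ≤ r s p m - p * b + |Pmax| * |a - b| := by
    intro a b p hp
    have h1 : p * (b - a) ≤ |p * (b - a)| := le_abs_self _
    have h2 : |p * (b - a)| ≤ |Pmax| * |a - b| := by
      rw [abs_mul, abs_sub_comm b a, abs_of_nonneg hp.1]
      gcongr
      exact hp.2.trans (le_abs_self _)
    linarith
  have hbdd : ∀ a b : ℝ, BddAbove ((fun p => r s p m - p * a) '' Icc 0 Pmax) →
      BddAbove ((fun p => r s p m - p * b) '' Icc 0 Pmax) := by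
    rintro a b ⟨B, hB⟩
    refine ⟨B + |Pmax| * |b - a|, ?_⟩
    rintro _ ⟨p, hp, rfl⟩
    have := hB ⟨p, hp, rfl⟩
    have := key b a p hp
    simp only at *
    linarith
  have hnn : 0 ≤ |Pmax| * |u - u'| := by positivity
  unfold hamiltonian
  rcases (Icc 0 Pmax).eq_empty_or_nonempty with he | hne
  · simpa [he] using hnn
  by_cases hb : BddAbove ((fun p => r s p m - p * u') '' Icc 0 Pmax)
  · refine csSup_le (hne.image _) ?_
    rintro _ ⟨p, hp, rfl⟩
    have h1 := le_csSup hb ⟨p, hp, rfl⟩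
    have h2 := key u u' p hp
    simp only at *
    linarith
  · -- an unbounded reward makes both suprema the junk value `0`
    rw [Real.sSup_of_not_bddAbove hb, Real.sSup_of_not_bddAbove fun h => hb (hbdd u u' h)]
    linarith

/-- The Hamiltonian is a supremum of affine functions of `u'` with slopes in `[-Pmax, 0]`. -/
theorem abs_hamiltonian_sub_le (Pmax : ℝ) (r : State → ℝ → (State → ℝ) → ℝ) (s : State)
    (u u' : ℝ) (m : State → ℝ) :
    |hamiltonian Pmax r s u m - hamiltonian Pmax r s u' m| ≤ |Pmax| * |u - u'| := by
  rw [abs_sub_le_iff]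
  have h1 := hamiltonian_le_add Pmax r s u u' m
  have h2 := hamiltonian_le_add Pmax r s u' u m
  rw [abs_sub_comm u' u] at h2
  constructor <;> linarith

theorem abs_derivU_le (Pmax : ℝ) (r : State → ℝ → (State → ℝ) → ℝ) (s : State)
    (u : ℝ) (m : State → ℝ) : |derivU (hamiltonian Pmax r) s u m| ≤ |Pmax| := by
  exact norm_deriv_le_of_lipschitz (C := ⟨|Pmax|, abs_nonneg _⟩)
    (f := fun u' => hamiltonian Pmax r s u' m) (x₀ := u)
    (LipschitzWith.of_dist_le_mul fun a b => abs_hamiltonian_sub_le Pmax r s a b m)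

/-! ### Densities and segments -/

theorem IsDensity.rapid {ι : Type*} {m : State → ℝ} (hm : IsDensity m) (S : Set ι) :
    RapidOn S (fun _ => m) := fun k => by
  obtain ⟨C, hC⟩ := hm.decay k
  exact ⟨C, fun _ _ s => hC s⟩

theorem IsDensity.integrable {m : State → ℝ} (hm : IsDensity m) : Integrable m :=
  (hm.rapid (univ : Set Unit)).integrable (mem_univ ()) hm.cont.aestronglyMeasurable

theorem segment_apply (m m' : State → ℝ) (lam : ℝ) (s : State) :
    (m + lam • (m' - m)) s = m s + lam * (m' s - m s) := by simp

theorem IsDensity.segment {m m' : State → ℝ} (hm : IsDensity m) (hm' : IsDensity m')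
    {lam : ℝ} (hl : lam ∈ Icc (0 : ℝ) 1) : IsDensity (m + lam • (m' - m)) where
  cont := hm.cont.add ((hm'.cont.sub hm.cont).const_smul lam)
  nonneg s := by
    rw [segment_apply]
    nlinarith [mul_nonneg (sub_nonneg.2 hl.2) (hm.nonneg s), mul_nonneg hl.1 (hm'.nonneg s)]
  decay := by
    have h : RapidOn (univ : Set Unit) (fun _ s => m s + lam * (m' s - m s)) :=
      (hm.rapid _).add ((PolyOn.const lam).mul_rapid ((hm'.rapid _).sub (hm.rapid _)))
    intro k
    obtain ⟨C, hC⟩ := h k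
    exact ⟨C, fun s => by rw [segment_apply]; exact hC () (mem_univ _) s⟩
  mass := by
    simp only [segment_apply]
    have h : Integrable fun s => m' s - m s := hm'.integrable.sub hm.integrable
    rw [integral_add hm.integrable (h.const_mul lam), integral_const_mul,
      integral_sub hm'.integrable hm.integrable, hm.mass, hm'.mass]
    ring

/-- Moving from `m_λ` towards the end point `m'` stays on the segment, which turns the one-sided
functional derivative into a right derivative in `λ`. -/
theorem hasDerivWithinAt_segment_right {F : (State → ℝ) → ℝ} {L : (State → ℝ) →ₗ[ℝ] ℝ}
    {m m' : State → ℝ} {lam : ℝ} (hl : lam < 1)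
    (hL : IsFunctionalDeriv F (m + lam • (m' - m)) L) (hm' : IsDensity m') :
    HasDerivWithinAt (fun σ : ℝ => F (m + σ • (m' - m))) (L (m' - m)) (Ici lam) lam := by
  have hc : 0 < 1 - lam := by linarith
  have h1 : m' - (m + lam • (m' - m)) = (1 - lam) • (m' - m) := by
    ext s
    simp
    ring
  have h2 := hL m' hm'
  rw [h1, map_smul, smul_eq_mul] at h2
  have h3 : Tendsto (fun σ : ℝ => (σ - lam) / (1 - lam)) (𝓝[>] lam) (𝓝[>] 0) := by
    refine tendsto_nhdsWithin_iff.2 ⟨?_, ?_⟩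
    · refine Tendsto.mono_left ?_ nhdsWithin_le_nhds
      have : Continuous fun σ : ℝ => (σ - lam) / (1 - lam) := by fun_prop
      simpa using this.tendsto lam
    · filter_upwards [self_mem_nhdsWithin] with σ hσ
      exact div_pos (sub_pos.2 hσ) hc
  have h4 := (h2.comp h3).div_const (1 - lam)
  rw [mul_div_cancel_left₀ _ hc.ne'] at h4
  rw [hasDerivWithinAt_iff_tendsto_slope]
  have hset : Ici lam \ {lam} = Ioi lam := by
    ext; simp
  rw [hset]
  refine h4.congr' ?_
  filter_upwards [self_mem_nhdsWithin] with σ hσ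
  have hσ' : σ - lam ≠ 0 := (sub_pos.2 hσ).ne'
  have h5 : m + lam • (m' - m) + ((σ - lam) / (1 - lam)) • (1 - lam) • (m' - m)
      = m + σ • (m' - m) := by
    rw [smul_smul, div_mul_cancel₀ _ hc.ne']
    ext s
    simp
    ring
  simp only [Function.comp_def, h5, slope_def_field]
  field_simp

theorem hasDerivWithinAt_segment_left {F : (State → ℝ) → ℝ} {L : (State → ℝ) →ₗ[ℝ] ℝ}
    {m m' : State → ℝ} {lam : ℝ} (hl : 0 < lam)
    (hL : IsFunctionalDeriv F (m + lam • (m' - m)) L) (hm : IsDensity m) :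
    HasDerivWithinAt (fun σ : ℝ => F (m + σ • (m' - m))) (L (m' - m)) (Iic lam) lam := by
  have hrev : ∀ σ : ℝ, m + σ • (m' - m) = m' + (1 - σ) • (m - m') := by
    intro σ
    ext s
    simp
    ring
  rw [hrev] at hL
  have h := hasDerivWithinAt_segment_right (by linarith : 1 - lam < 1) hL hm
  have h2 := h.scomp (s := Iic lam) lam (h := fun σ => 1 - σ)
    (((hasDerivAt_id lam).const_sub 1).hasDerivWithinAt) (fun σ hσ => by
      simp only [mem_Iic, mem_Ici] at *
      linarith)
  simp only [Function.comp_def, ← hrev] at h2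
  convert! h2 using 1
  rw [show m - m' = -(m' - m) by abel, map_neg]
  simp

theorem hasDerivAt_segment {F : (State → ℝ) → ℝ} {L : (State → ℝ) →ₗ[ℝ] ℝ}
    {m m' : State → ℝ} {lam : ℝ} (hl : lam ∈ Ioo (0 : ℝ) 1)
    (hL : IsFunctionalDeriv F (m + lam • (m' - m)) L) (hm : IsDensity m) (hm' : IsDensity m') :
    HasDerivAt (fun σ : ℝ => F (m + σ • (m' - m))) (L (m' - m)) lam := by
  have := (hasDerivWithinAt_segment_left hl.1 hL hm).union
    (hasDerivWithinAt_segment_right hl.2 hL hm')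
  rwa [Iic_union_Ici, hasDerivWithinAt_univ] at this

theorem continuousOn_segment {F : (State → ℝ) → ℝ} {L : (State → ℝ) → (State → ℝ) →ₗ[ℝ] ℝ}
    (hL : ∀ n, IsDensity n → IsFunctionalDeriv F n (L n))
    {m m' : State → ℝ} (hm : IsDensity m) (hm' : IsDensity m') :
    ContinuousOn (fun σ : ℝ => F (m + σ • (m' - m))) (Icc 0 1) := by
  intro lam hl
  have hLl := hL _ (hm.segment hm' hl)
  rcases eq_or_lt_of_le hl.1 with rfl | h0
  · exact (hasDerivWithinAt_segment_right one_pos hLl hm').continuousWithinAt.mono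
      Icc_subset_Ici_self
  rcases eq_or_lt_of_le hl.2 with rfl | h1
  · exact (hasDerivWithinAt_segment_left one_pos hLl hm).continuousWithinAt.mono
      Icc_subset_Iic_self
  · exact (hasDerivAt_segment ⟨h0, h1⟩ hLl hm hm').continuousAt.continuousWithinAt

/-! ### Functions of `u'` and of a parameter -/

/-- The chain rule along `λ ↦ (u + λ y, λ)` for a function with continuous partial derivatives. -/
theorem hasDerivAt_path {G G₁ G₂ : ℝ → ℝ → ℝ}
    (h₁ : ∀ u, ∀ l ∈ Ioo (0 : ℝ) 1, HasDerivAt (fun u' => G u' l) (G₁ u l) u)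
    (h₂ : ∀ u, ∀ l ∈ Ioo (0 : ℝ) 1, HasDerivAt (fun l' => G u l') (G₂ u l) l)
    (c₁ : ContinuousOn (fun z : ℝ × ℝ => G₁ z.1 z.2) (univ ×ˢ Ioo 0 1))
    (c₂ : ContinuousOn (fun z : ℝ × ℝ => G₂ z.1 z.2) (univ ×ˢ Ioo 0 1)) :
    ContinuousOn (fun z : ℝ × ℝ => G z.1 z.2) (univ ×ˢ Ioo 0 1) ∧
    ∀ a y : ℝ, ∀ l ∈ Ioo (0 : ℝ) 1,
      HasDerivAt (fun l' => G (a + l' * y) l') (G₁ (a + l * y) l * y + G₂ (a + l * y) l) l := by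
  have key : ∀ u, ∀ l ∈ Ioo (0 : ℝ) 1, HasStrictFDerivAt (fun z : ℝ × ℝ => G z.1 z.2)
      ((ContinuousLinearMap.toSpanSingleton ℝ (G₁ u l)).coprod
        (ContinuousLinearMap.toSpanSingleton ℝ (G₂ u l))) (u, l) := by
    intro u l hl
    have hn : (univ ×ˢ Ioo (0 : ℝ) 1 : Set (ℝ × ℝ)) ∈ 𝓝 (u, l) :=
      (isOpen_univ.prod isOpen_Ioo).mem_nhds ⟨mem_univ _, hl⟩
    have htsp : Continuous fun c : ℝ => ContinuousLinearMap.toSpanSingleton ℝ c :=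
      (ContinuousLinearMap.toSpanSingletonCLE (𝕜 := ℝ) (E := ℝ)).continuous
    exact hasStrictFDerivAt_uncurry_coprod (u := (u, l)) (f := G)
      (f₁ := fun a b => ContinuousLinearMap.toSpanSingleton ℝ (G₁ a b))
      (f₂ := fun a b => ContinuousLinearMap.toSpanSingleton ℝ (G₂ a b))
      (by filter_upwards [hn] with z hz using (h₁ z.1 z.2 hz.2).hasFDerivAt)
      (by filter_upwards [hn] with z hz using (h₂ z.1 z.2 hz.2).hasFDerivAt)
      (htsp.continuousAt.comp (c₁.continuousAt hn))
      (htsp.continuousAt.comp (c₂.continuousAt hn))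
  refine ⟨fun z hz => (key z.1 z.2 hz.2).hasFDerivAt.continuousAt.continuousWithinAt,
    fun a y l hl => ?_⟩
  have hγ : HasDerivAt (fun l' : ℝ => (a + l' * y, l')) (y, (1 : ℝ)) l := by
    refine HasDerivAt.prodMk ?_ (hasDerivAt_id l)
    simpa using ((hasDerivAt_id l).mul_const y).const_add a
  have := (key (a + l * y) l hl).hasFDerivAt.comp_hasDerivAt_of_eq l hγ rfl
  convert! this using 1
  simp [mul_comm]

theorem continuousOn_path {G : ℝ → ℝ → ℝ} {a y B : ℝ}
    (hc : ∀ u, ContinuousOn (fun l => G u l) (Icc 0 1))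
    (hB : ∀ l ∈ Icc (0 : ℝ) 1, ∀ l₁ ∈ Icc (0 : ℝ) 1,
      |G (a + l * y) l - G (a + l₁ * y) l| ≤ B * |l - l₁|) :
    ContinuousOn (fun l => G (a + l * y) l) (Icc 0 1) := by
  intro l₁ hl₁
  have h1 : Tendsto (fun l => G (a + l₁ * y) l) (𝓝[Icc 0 1] l₁) (𝓝 (G (a + l₁ * y) l₁)) :=
    hc _ l₁ hl₁
  have h2 : Tendsto (fun l => G (a + l * y) l - G (a + l₁ * y) l) (𝓝[Icc 0 1] l₁) (𝓝 0) := by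
    have h3 : Tendsto (fun l => B * |l - l₁|) (𝓝[Icc 0 1] l₁) (𝓝 0) := by
      have : Continuous fun l => B * |l - l₁| := by fun_prop
      simpa using (this.tendsto l₁).mono_left nhdsWithin_le_nhds
    refine squeeze_zero_norm' ?_ h3
    filter_upwards [self_mem_nhdsWithin] with l hl using hB l hl l₁ hl₁
  have := h2.add h1
  simpa [ContinuousWithinAt] using this

/-! ### Convexity along the segment between two solutions -/

theorem PolyOn.of_growth {ι : Type*} {S : Set ι} {f v : ι → State → ℝ} (hv : PolyOn S v)
    {C : ℝ} {k : ℕ} (h : ∀ i ∈ S, ∀ s, |f i s| ≤ C * (1 + ‖s‖ + |v i s|) ^ k) :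
    PolyOn S f := by
  obtain ⟨D, l, hD, hv⟩ := hv.exists_nonneg
  refine ⟨|C| * (1 + D) ^ k, (l + 1) * k, fun i hi s => ?_⟩
  have h1 := one_le_one_add_norm s
  have e1 : 1 + ‖s‖ ≤ (1 + ‖s‖) ^ (l + 1) := le_self_pow₀ h1 (by omega)
  have e2 : (1 + ‖s‖) ^ l ≤ (1 + ‖s‖) ^ (l + 1) := pow_le_pow_right₀ h1 (by omega)
  have e3 : 1 + ‖s‖ + |v i s| ≤ (1 + D) * (1 + ‖s‖) ^ (l + 1) := by
    have := mul_le_mul_of_nonneg_left e2 hD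
    linarith [hv i hi s]
  calc |f i s| ≤ C * (1 + ‖s‖ + |v i s|) ^ k := h i hi s
    _ ≤ |C| * ((1 + D) * (1 + ‖s‖) ^ (l + 1)) ^ k := by
      gcongr
      exact le_abs_self C
    _ = _ := by rw [mul_pow, ← pow_mul, mul_assoc]

theorem PolyOn.param (a b : ℝ) : PolyOn (Icc a b) (fun l (_ : State) => l) :=
  ⟨|a| + |b|, 0, fun l hl _ => by
    simp only [pow_zero, mul_one]
    exact (abs_le_max_abs_abs hl.1 hl.2).trans
      (max_le (by linarith [abs_nonneg b]) (by linarith [abs_nonneg a]))⟩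

theorem IsProfile.poly {ι : Type*} {u : State → ℝ} (hu : IsProfile u) (S : Set ι) :
    PolyOn S (fun _ => u) := by
  obtain ⟨C, k, h⟩ := hu.2
  exact ⟨C, k, fun _ _ s => h s⟩

theorem IsProfile.segment {u₁ u₂ : State → ℝ} (h₁ : IsProfile u₁) (h₂ : IsProfile u₂) (l : ℝ) :
    IsProfile (fun s => u₁ s + l * (u₂ s - u₁ s)) := by
  refine ⟨h₁.1.add (continuous_const.mul (h₂.1.sub h₁.1)), ?_⟩
  obtain ⟨C, k, h⟩ := (h₁.poly (univ : Set Unit)).add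
    (((h₂.poly univ).sub (h₁.poly univ)).const_mul l)
  exact ⟨C, k, fun s => h () (mem_univ _) s⟩

/-- `m_λ y ∂_{u'}H̃(u_λ, m_λ) - H̃(u_λ, m_λ) x` along `m_λ = m₁ + λ x`, `u_λ = u₁ + λ y`, where
`x = m₂ - m₁` and `y = u₂ - u₁`. -/
def pathIntegrand (H : State → ℝ → (State → ℝ) → ℝ) (u₁ u₂ m₁ m₂ : State → ℝ) (l : ℝ)
    (s : State) : ℝ :=
  (u₂ s - u₁ s) * ((m₁ s + l * (m₂ s - m₁ s)) *
      derivU H s (u₁ s + l * (u₂ s - u₁ s)) (m₁ + l • (m₂ - m₁)))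
    - H s (u₁ s + l * (u₂ s - u₁ s)) (m₁ + l • (m₂ - m₁)) * (m₂ s - m₁ s)

/-- The derivative of `pathIntegrand` in `λ`: the quadratic form of the block operator
`(A₁₁, A₁₂; A₁₂*, a₂₂)` at `(x, y)`, before integration over the state. -/
def pathDeriv (H : State → ℝ → (State → ℝ) → ℝ)
    (Hm Hum : State → ℝ → (State → ℝ) → ((State → ℝ) →ₗ[ℝ] ℝ))
    (u₁ u₂ m₁ m₂ : State → ℝ) (l : ℝ) (s : State) : ℝ :=
  (m₁ s + l * (m₂ s - m₁ s)) *
      (derivUU H s (u₁ s + l * (u₂ s - u₁ s)) (m₁ + l • (m₂ - m₁)) * (u₂ s - u₁ s)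
        + Hum s (u₁ s + l * (u₂ s - u₁ s)) (m₁ + l • (m₂ - m₁)) (m₂ - m₁)) * (u₂ s - u₁ s)
    - (m₂ s - m₁ s) * Hm s (u₁ s + l * (u₂ s - u₁ s)) (m₁ + l • (m₂ - m₁)) (m₂ - m₁)

section regular

variable {H : State → ℝ → (State → ℝ) → ℝ}
  {Hm Hum : State → ℝ → (State → ℝ) → ((State → ℝ) →ₗ[ℝ] ℝ)}

theorem RegularHamiltonian.hasDerivAt_u (hreg : RegularHamiltonian H Hm Hum) (s : State) (u : ℝ)
    {m : State → ℝ} (hm : IsDensity m) : HasDerivAt (fun u' => H s u' m) (derivU H s u m) u :=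
  ((hreg.diff_u s m hm).differentiable (by norm_num) u).hasDerivAt

theorem RegularHamiltonian.hasDerivAt_derivU (hreg : RegularHamiltonian H Hm Hum) (s : State)
    (u : ℝ) {m : State → ℝ} (hm : IsDensity m) :
    HasDerivAt (fun u' => derivU H s u' m) (derivUU H s u m) u :=
  ((hreg.diff_u s m hm).differentiable_deriv_two u).hasDerivAt

theorem RegularHamiltonian.measurable_derivU (hreg : RegularHamiltonian H Hm Hum)
    {m : State → ℝ} (hm : IsDensity m) :
    Measurable (fun z : State × ℝ => derivU H z.1 z.2 m) := by
  refine measurable_of_hasDerivAt (F := fun τ z => H z.1 (z.2 + τ) m) (t := 0)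
    (Eventually.of_forall fun τ => ?_) fun z => ?_
  · exact (hreg.meas m hm).comp (measurable_fst.prodMk (measurable_snd.add_const τ))
  · have h := hreg.hasDerivAt_u z.1 (z.2 + 0) hm
    have := h.comp_const_add z.2 0
    simpa using this

variable {u₁ u₂ m₁ m₂ : State → ℝ}

theorem measurable_pathIntegrand (hreg : RegularHamiltonian H Hm Hum)
    (hu₁ : IsProfile u₁) (hu₂ : IsProfile u₂) (hm₁ : IsDensity m₁) (hm₂ : IsDensity m₂)
    {l : ℝ} (hl : l ∈ Icc (0 : ℝ) 1) : Measurable (pathIntegrand H u₁ u₂ m₁ m₂ l) := by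
  have hm := hm₁.segment hm₂ hl
  have a₁ := hu₁.1.measurable
  have a₂ := hu₂.1.measurable
  have b₁ := hm₁.cont.measurable
  have b₂ := hm₂.cont.measurable
  have hpair : Measurable fun s => (s, u₁ s + l * (u₂ s - u₁ s)) :=
    measurable_id.prodMk (a₁.add ((a₂.sub a₁).const_mul l))
  exact ((a₂.sub a₁).mul ((b₁.add ((b₂.sub b₁).const_mul l)).mul
    ((hreg.measurable_derivU hm).comp hpair))).sub
      (((hreg.meas _ hm).comp hpair).mul (b₂.sub b₁))

theorem hasDerivAt_pathIntegrand (hreg : RegularHamiltonian H Hm Hum)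
    (hm₁ : IsDensity m₁) (hm₂ : IsDensity m₂) (s : State) {l : ℝ} (hl : l ∈ Ioo (0 : ℝ) 1) :
    HasDerivAt (fun l' => pathIntegrand H u₁ u₂ m₁ m₂ l' s)
      (pathDeriv H Hm Hum u₁ u₂ m₁ m₂ l s) l := by
  have hden : ∀ l ∈ Ioo (0 : ℝ) 1, IsDensity (m₁ + l • (m₂ - m₁)) := fun l hl =>
    hm₁.segment hm₂ (Ioo_subset_Icc_self hl)
  have hsub : (univ ×ˢ Ioo (0 : ℝ) 1 : Set (ℝ × ℝ)) ⊆ univ ×ˢ Icc 0 1 :=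
    prod_mono_right Ioo_subset_Icc_self
  obtain ⟨cU, dU⟩ := hasDerivAt_path (G := fun u l => derivU H s u (m₁ + l • (m₂ - m₁)))
    (G₁ := fun u l => derivUU H s u (m₁ + l • (m₂ - m₁)))
    (G₂ := fun u l => Hum s u (m₁ + l • (m₂ - m₁)) (m₂ - m₁))
    (fun u l hl => hreg.hasDerivAt_derivU s u (hden l hl))
    (fun u l hl => hasDerivAt_segment (F := fun n => derivU H s u n) hl
      (hreg.diff_um s u _ (hden l hl)) hm₁ hm₂)
    ((hreg.cont_uu s m₁ m₂ hm₁ hm₂).mono hsub) ((hreg.cont_um s m₁ m₂ hm₁ hm₂).mono hsub)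
  obtain ⟨-, dH⟩ := hasDerivAt_path (G := fun u l => H s u (m₁ + l • (m₂ - m₁)))
    (G₁ := fun u l => derivU H s u (m₁ + l • (m₂ - m₁)))
    (G₂ := fun u l => Hm s u (m₁ + l • (m₂ - m₁)) (m₂ - m₁))
    (fun u l hl => hreg.hasDerivAt_u s u (hden l hl))
    (fun u l hl => hasDerivAt_segment (F := fun n => H s u n) hl
      (hreg.diff_m s u _ (hden l hl)) hm₁ hm₂)
    cU ((hreg.cont_m s m₁ m₂ hm₁ hm₂).mono hsub)
  have hm : HasDerivAt (fun l' : ℝ => m₁ s + l' * (m₂ s - m₁ s)) (m₂ s - m₁ s) l := by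
    simpa using ((hasDerivAt_id l).mul_const (m₂ s - m₁ s)).const_add (m₁ s)
  have := ((hm.mul (dU (u₁ s) (u₂ s - u₁ s) l hl)).const_mul (u₂ s - u₁ s)).sub
    ((dH (u₁ s) (u₂ s - u₁ s) l hl).mul_const (m₂ s - m₁ s))
  convert! this using 1
  simp only [pathDeriv]
  ring

theorem rapid_pathDeriv (hreg : RegularHamiltonian H Hm Hum)
    (hu₁ : IsProfile u₁) (hu₂ : IsProfile u₂) (hm₁ : IsDensity m₁) (hm₂ : IsDensity m₂) :
    RapidOn (Icc 0 1) (pathDeriv H Hm Hum u₁ u₂ m₁ m₂) := by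
  obtain ⟨C, k, hC⟩ := hreg.growth m₁ m₂ hm₁ hm₂
  have y := (hu₂.poly (Icc (0 : ℝ) 1)).sub (hu₁.poly _)
  have x := (hm₂.rapid (Icc (0 : ℝ) 1)).sub (hm₁.rapid _)
  have ul := (hu₁.poly _).add ((PolyOn.param 0 1).mul y)
  have ml := (hm₁.rapid _).add ((PolyOn.param 0 1).mul_rapid x)
  have g₁ := ul.of_growth (f := fun l s => derivUU H s (u₁ s + l * (u₂ s - u₁ s))
    (m₁ + l • (m₂ - m₁))) fun l hl s => (hC s _ l hl).1
  have g₂ := ul.of_growth (f := fun l s => Hm s (u₁ s + l * (u₂ s - u₁ s))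
    (m₁ + l • (m₂ - m₁)) (m₂ - m₁)) fun l hl s => (hC s _ l hl).2.1
  have g₃ := ul.of_growth (f := fun l s => Hum s (u₁ s + l * (u₂ s - u₁ s))
    (m₁ + l • (m₂ - m₁)) (m₂ - m₁)) fun l hl s => (hC s _ l hl).2.2
  exact ((ml.mul_poly ((g₁.mul y).add g₃)).mul_poly y).sub (x.mul_poly g₂)

theorem continuousOn_pathIntegrand (hreg : RegularHamiltonian H Hm Hum)
    {P : ℝ} (hP : ∀ s u m, |derivU H s u m| ≤ P)
    (hm₁ : IsDensity m₁) (hm₂ : IsDensity m₂) (s : State) :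
    ContinuousOn (fun l => pathIntegrand H u₁ u₂ m₁ m₂ l s) (Icc 0 1) := by
  obtain ⟨C, k, hC⟩ := hreg.growth m₁ m₂ hm₁ hm₂
  set a := u₁ s
  set y := u₂ s - u₁ s
  have hsub : ∀ l l₁ : ℝ, |a + l * y - (a + l₁ * y)| = |y| * |l - l₁| := fun l l₁ => by
    rw [← abs_mul]
    congr 1
    ring
  have hU : ContinuousOn (fun l => derivU H s (a + l * y) (m₁ + l • (m₂ - m₁))) (Icc 0 1) := by
    refine continuousOn_path (G := fun u l => derivU H s u (m₁ + l • (m₂ - m₁)))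
      (B := |C| * (1 + ‖s‖ + (|a| + |y|)) ^ k * |y|)
      (fun u => continuousOn_segment (F := fun n => derivU H s u n) (hreg.diff_um s u) hm₁ hm₂)
      fun l hl l₁ hl₁ => ?_
    have hmem : ∀ l ∈ Icc (0 : ℝ) 1, a + l * y ∈ Icc (-(|a| + |y|)) (|a| + |y|) := by
      intro l hl
      refine abs_le.1 ((abs_add_le _ _).trans ?_)
      rw [abs_mul, abs_of_nonneg hl.1]
      nlinarith [abs_nonneg y, hl.2]
    have := (convex_Icc (-(|a| + |y|)) (|a| + |y|)).norm_image_sub_le_of_norm_hasDerivWithin_le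
      (f := fun u => derivU H s u (m₁ + l • (m₂ - m₁)))
      (f' := fun u => derivUU H s u (m₁ + l • (m₂ - m₁)))
      (C := |C| * (1 + ‖s‖ + (|a| + |y|)) ^ k)
      (fun u _ => (hreg.hasDerivAt_derivU s u (hm₁.segment hm₂ hl)).hasDerivWithinAt)
      (fun u hu => by
        refine (hC s u l hl).1.trans ?_
        have := abs_le.2 hu
        gcongr
        exact le_abs_self C)
      (hmem l₁ hl₁) (hmem l hl)
    simp only [Real.norm_eq_abs, hsub] at this
    rwa [mul_assoc]
  have hH : ContinuousOn (fun l => H s (a + l * y) (m₁ + l • (m₂ - m₁))) (Icc 0 1) := by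
    refine continuousOn_path (G := fun u l => H s u (m₁ + l • (m₂ - m₁))) (B := P * |y|)
      (fun u => continuousOn_segment (F := fun n => H s u n) (hreg.diff_m s u) hm₁ hm₂)
      fun l hl l₁ hl₁ => ?_
    have := convex_univ.norm_image_sub_le_of_norm_hasDerivWithin_le
      (f := fun u => H s u (m₁ + l • (m₂ - m₁))) (C := P)
      (fun u _ => (hreg.hasDerivAt_u s u (hm₁.segment hm₂ hl)).hasDerivWithinAt)
      (fun u _ => hP s u _) (mem_univ (a + l₁ * y)) (mem_univ (a + l * y))
    simp only [Real.norm_eq_abs, hsub] at this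
    rwa [mul_assoc]
  have hm : Continuous fun l : ℝ => m₁ s + l * (m₂ s - m₁ s) := by fun_prop
  exact (continuousOn_const.mul (hm.continuousOn.mul hU)).sub (hH.mul continuousOn_const)

/-- The completed square: the discarded term is `m a₂₂ (y + a₂₂⁻¹ A₁₂ x)²`. -/
theorem schur_le_pathDeriv (huu : ∀ s u m, IsDensity m → 0 < derivUU H s u m)
    (hm₁ : IsDensity m₁) (hm₂ : IsDensity m₂) {l : ℝ} (hl : l ∈ Ioo (0 : ℝ) 1) (s : State) :
    ((m₂ - (m₁ + l • (m₂ - m₁))) s *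
        opM Hm (fun s => u₁ s + l * (u₂ s - u₁ s)) (m₁ + l • (m₂ - m₁))
          (m₂ - (m₁ + l • (m₂ - m₁))) s
      - ((1 / 2) * opUM Hum (fun s => u₁ s + l * (u₂ s - u₁ s)) (m₁ + l • (m₂ - m₁))
          (m₂ - (m₁ + l • (m₂ - m₁))) s) ^ 2 /
        derivUU H s (u₁ s + l * (u₂ s - u₁ s)) (m₁ + l • (m₂ - m₁)))
        * (m₁ + l • (m₂ - m₁)) s
      ≤ (1 - l) ^ 2 * pathDeriv H Hm Hum u₁ u₂ m₁ m₂ l s := by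
  have hd := hm₁.segment hm₂ (Ioo_subset_Icc_self hl)
  have ha := huu s (u₁ s + l * (u₂ s - u₁ s)) _ hd
  have hM := hd.nonneg s
  have hx : m₂ - (m₁ + l • (m₂ - m₁)) = (1 - l) • (m₂ - m₁) := by
    ext s
    simp
    ring
  rw [hx]
  simp only [pathDeriv, opM, opUM, map_smul, smul_eq_mul, Pi.smul_apply, Pi.sub_apply]
  rw [segment_apply] at hM ⊢
  generalize derivUU H s _ _ = a at ha ⊢
  generalize Hum s _ _ _ = b
  generalize Hm s _ _ _ = d
  rcases hM.eq_or_lt with h0 | hpos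
  · have e1 := mul_nonneg (sub_pos.2 hl.2).le (hm₁.nonneg s)
    have e3 := mul_nonneg hl.1.le (hm₂.nonneg s)
    have z1 : (1 - l) * m₁ s = 0 := by linarith
    have z2 : l * m₂ s = 0 := by linarith
    rw [(mul_eq_zero.1 z1).resolve_left (sub_pos.2 hl.2).ne',
      (mul_eq_zero.1 z2).resolve_left hl.1.ne']
    simp
  · generalize m₁ s + l * (m₂ s - m₁ s) = M at hpos ⊢
    rw [← sub_nonneg]
    have : (1 - l) ^ 2 * (M * (a * (u₂ s - u₁ s) + b) * (u₂ s - u₁ s) - (m₂ s - m₁ s) * d)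
        - ((1 - l) * (m₂ s - m₁ s) * (-(1 / M) * ((1 - l) * d))
          - (1 / 2 * ((1 - l) * b)) ^ 2 / a) * M
        = (1 - l) ^ 2 * M * a * (u₂ s - u₁ s + b / (2 * a)) ^ 2 := by
      field_simp
      ring
    rw [this]
    positivity

theorem pathDeriv_of_eq (h : m₁ = m₂) (l : ℝ) (s : State) :
    pathDeriv H Hm Hum u₁ u₂ m₁ m₂ l s
      = m₁ s * derivUU H s (u₁ s + l * (u₂ s - u₁ s)) m₁ * (u₂ s - u₁ s) ^ 2 := by
  subst h
  simp [pathDeriv]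
  ring

/-- Strict monotonicity: the integral over the state of
`y (m₂ ∂_{u'}H̃₂ - m₁ ∂_{u'}H̃₁) - (H̃₂ - H̃₁) x` is nonnegative, and positive unless `x = 0`. -/
theorem integral_path_pos (hreg : RegularHamiltonian H Hm Hum)
    {P : ℝ} (hP : ∀ s u m, |derivU H s u m| ≤ P)
    (huu : ∀ s u m, IsDensity m → 0 < derivUU H s u m)
    (hschur : ∀ u m, IsProfile u → IsDensity m → PositiveForm m (formSchur H Hm Hum u m))
    (hu₁ : IsProfile u₁) (hu₂ : IsProfile u₂) (hm₁ : IsDensity m₁) (hm₂ : IsDensity m₂)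
    (hH : PolyOn (univ : Set Unit) (fun _ s => H s (u₁ s) m₁)) :
    Integrable (fun s => (u₂ s - u₁ s) *
          (m₂ s * derivU H s (u₂ s) m₂ - m₁ s * derivU H s (u₁ s) m₁)
        - (H s (u₂ s) m₂ - H s (u₁ s) m₁) * (m₂ s - m₁ s)) ∧
      0 ≤ ∫ s, ((u₂ s - u₁ s) *
          (m₂ s * derivU H s (u₂ s) m₂ - m₁ s * derivU H s (u₁ s) m₁)
        - (H s (u₂ s) m₂ - H s (u₁ s) m₁) * (m₂ s - m₁ s)) ∧
      (m₁ ≠ m₂ → 0 < ∫ s, ((u₂ s - u₁ s) *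
          (m₂ s * derivU H s (u₂ s) m₂ - m₁ s * derivU H s (u₁ s) m₁)
        - (H s (u₂ s) m₂ - H s (u₁ s) m₁) * (m₂ s - m₁ s))) := by
  have k0 : ∀ s, pathIntegrand H u₁ u₂ m₁ m₂ 0 s = (u₂ s - u₁ s) * (m₁ s * derivU H s (u₁ s) m₁)
      - H s (u₁ s) m₁ * (m₂ s - m₁ s) := fun s => by simp [pathIntegrand]
  have k1 : ∀ s, pathIntegrand H u₁ u₂ m₁ m₂ 1 s = (u₂ s - u₁ s) * (m₂ s * derivU H s (u₂ s) m₂)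
      - H s (u₂ s) m₂ * (m₂ s - m₁ s) := fun s => by simp [pathIntegrand]
  have hFa : RapidOn (Icc (0 : ℝ) 1) (fun _ => pathIntegrand H u₁ u₂ m₁ m₂ 0) := by
    have hU : PolyOn (Icc (0 : ℝ) 1) (fun _ s => derivU H s (u₁ s) m₁) :=
      ⟨P, 0, fun _ _ s => by simpa using hP s _ _⟩
    refine RapidOn.congr ?_ fun _ _ s => k0 s
    exact (((hu₂.poly _).sub (hu₁.poly _)).mul_rapid ((hm₁.rapid _).mul_poly hU)).sub
      ((hH.fix (mem_univ ()) _).mul_rapid ((hm₂.rapid _).sub (hm₁.rapid _)))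
  have hmeas : ∀ l ∈ Icc (0 : ℝ) 1, Measurable (pathIntegrand H u₁ u₂ m₁ m₂ l) := fun l hl =>
    measurable_pathIntegrand hreg hu₁ hu₂ hm₁ hm₂ hl
  obtain ⟨hrap, hcont, hder⟩ := hasDerivAt_integral_of_rapid hmeas hFa
    (rapid_pathDeriv hreg hu₁ hu₂ hm₁ hm₂)
    (continuousOn_pathIntegrand hreg hP hm₁ hm₂)
    (fun s l hl => hasDerivAt_pathIntegrand hreg hm₁ hm₂ s hl)
  have h0 : (0 : ℝ) ∈ Icc (0 : ℝ) 1 := by simp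
  have h1 : (1 : ℝ) ∈ Icc (0 : ℝ) 1 := by simp
  have i0 := hrap.integrable h0 (hmeas 0 h0).aestronglyMeasurable
  have i1 := hrap.integrable h1 (hmeas 1 h1).aestronglyMeasurable
  have hsub : (fun s => (u₂ s - u₁ s) *
          (m₂ s * derivU H s (u₂ s) m₂ - m₁ s * derivU H s (u₁ s) m₁)
        - (H s (u₂ s) m₂ - H s (u₁ s) m₁) * (m₂ s - m₁ s))
      = fun s => pathIntegrand H u₁ u₂ m₁ m₂ 1 s - pathIntegrand H u₁ u₂ m₁ m₂ 0 s := by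
    ext s
    rw [k0, k1]
    ring
  rw [hsub, integral_sub i1 i0]
  refine ⟨i1.sub i0, ?_⟩
  have hpos : m₁ ≠ m₂ → ∀ l ∈ Ioo (0 : ℝ) 1,
      0 < ∫ s, pathDeriv H Hm Hum u₁ u₂ m₁ m₂ l s := by
    intro hne l hl
    have hd := hm₁.segment hm₂ (Ioo_subset_Icc_self hl)
    have hc : 0 < 1 - l := by linarith [hl.2]
    have hx : m₂ - (m₁ + l • (m₂ - m₁)) = (1 - l) • (m₂ - m₁) := by
      ext s
      simp
      ring
    -- `m₂ - m_λ` is a direction at `m_λ`, because `m_λ ≥ λ m₂` vanishes only where `m₂` does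
    have hdir : IsDirection (m₁ + l • (m₂ - m₁)) (m₂ - (m₁ + l • (m₂ - m₁))) := by
      refine ⟨m₂, hm₂, fun s hs => ?_, rfl⟩
      rw [segment_apply] at hs
      have e1 := mul_nonneg hc.le (hm₁.nonneg s)
      have e2 := hm₂.nonneg s
      have e3 := mul_nonneg hl.1.le e2
      have : l * m₂ s = 0 := by linarith
      exact (mul_eq_zero.1 this).resolve_left hl.1.ne'
    have hne' : m₂ - (m₁ + l • (m₂ - m₁)) ≠ 0 := by
      rw [hx]
      exact smul_ne_zero hc.ne' (sub_ne_zero.2 hne.symm)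
    have hS := hschur _ _ (hu₁.segment hu₂ l) hd _ hdir hne'
    -- a positive Bochner integral has an integrable integrand
    have hSi := Integrable.of_integral_ne_zero hS.ne'
    have hle := integral_mono hSi ((hder l hl).1.const_mul ((1 - l) ^ 2))
      fun s => schur_le_pathDeriv huu hm₁ hm₂ hl s
    rw [integral_const_mul] at hle
    exact pos_of_mul_pos_right (hS.trans_le hle) (by positivity)
  have hnn : ∀ l ∈ Ioo (0 : ℝ) 1, 0 ≤ ∫ s, pathDeriv H Hm Hum u₁ u₂ m₁ m₂ l s := by
    intro l hl
    by_cases hne : m₁ = m₂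
    · refine integral_nonneg fun s => ?_
      rw [pathDeriv_of_eq hne]
      have := hm₁.nonneg s
      have := huu s (u₁ s + l * (u₂ s - u₁ s)) m₁ hm₁
      positivity
    · exact (hpos hne l hl).le
  constructor
  · have := monotoneOn_of_deriv_nonneg (convex_Icc (0 : ℝ) 1) hcont
      (fun l hl => by
        rw [interior_Icc] at hl
        exact (hder l hl).2.differentiableAt.differentiableWithinAt)
      (fun l hl => by
        rw [interior_Icc] at hl
        rw [(hder l hl).2.deriv]
        exact hnn l hl)
    exact sub_nonneg.2 (this h0 h1 zero_le_one)
  · intro hne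
    have := strictMonoOn_of_deriv_pos (convex_Icc (0 : ℝ) 1) hcont
      (fun l hl => by
        rw [interior_Icc] at hl
        rw [(hder l hl).2.deriv]
        exact hpos hne l hl)
    exact sub_pos.2 (this h0 h1 zero_lt_one)

end regular

/-! ### The duality pairing of the two equations -/

section energy

variable {T T' : ℝ}

theorem IsC12.sub {G : (ℝ → State → ℝ) → Prop}
    (hsub : ∀ f g, G f → G g → G fun t s => f t s - g t s)
    (hcongr : ∀ f g, G g → (∀ t ∈ Icc T T', ∀ s, f t s = g t s) → G f)
    {f g : ℝ → State → ℝ} (hf : IsC12 T T' G f) (hg : IsC12 T T' G g) :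
    IsC12 T T' G (fun t s => f t s - g t s) := by
  have h1 : ∀ i, ∀ t ∈ Icc T T', pd i (fun s => f t s - g t s)
      = fun s => pd i (f t) s - pd i (g t) s := fun i t ht => by
    ext s
    exact pd_sub (.of_contDiff (hf.diff_state t ht)) (.of_contDiff (hg.diff_state t ht)) s
  refine ⟨fun t ht s => (hf.diff_time t ht s).sub (hg.diff_time t ht s),
    fun t ht => (hf.diff_state t ht).sub (hg.diff_state t ht), fun t ht => ?_, fun t ht => ?_,
    hsub _ _ hf.growth hg.growth, ?_, fun i => ?_, ?_, ?_⟩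
  · rw [h1 1 t ht]
    exact (hf.diff_state_one t ht).sub (hg.diff_state_one t ht)
  · rw [h1 2 t ht]
    exact (hf.diff_state_two t ht).sub (hg.diff_state_two t ht)
  · exact hcongr _ _ (hsub _ _ hf.growth_time hg.growth_time) fun t ht s =>
      derivWithin_fun_sub (hf.diff_time t ht s) (hg.diff_time t ht s)
  · exact hcongr _ _ (hsub _ _ (hf.growth_state i) (hg.growth_state i)) fun t ht s => by
      rw [h1 i t ht]
  · refine hcongr _ _ (hsub _ _ hf.growth_one_one hg.growth_one_one) fun t ht s => ?_
    rw [h1 1 t ht]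
    exact pd_sub (.of_contDiff (hf.diff_state_one t ht)) (.of_contDiff (hg.diff_state_one t ht)) s
  · refine hcongr _ _ (hsub _ _ hf.growth_two_two hg.growth_two_two) fun t ht s => ?_
    rw [h1 2 t ht]
    exact pd_sub (.of_contDiff (hf.diff_state_two t ht)) (.of_contDiff (hg.diff_state_two t ht)) s

theorem integral_pd_eq_zero_of_rapid {ι : Type*} {S : Set ι} {i : Fin 3} {p : ι → State → ℝ}
    {t : ι} (ht : t ∈ S) (hp : PDiff i (p t)) (hm : Measurable (p t)) (h : RapidOn S p)
    (h' : RapidOn S fun t => pd i (p t)) :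
    Integrable (pd i (p t)) ∧ ∫ s, pd i (p t) s = 0 := by
  have e := h'.integrable ht (measurable_pd hp hm).aestronglyMeasurable
  exact ⟨e, integral_pd_eq_zero hp (h.integrable ht hm.aestronglyMeasurable) e⟩

theorem contDiff_drift (a : ℝ) (i : Fin 3) :
    ContDiff ℝ 1 (fun z : State => (1 / 2) * (a - z i)) := by
  fun_prop

theorem pd_drift (a : ℝ) (i : Fin 3) (s : State) :
    pd i (fun z : State => (1 / 2) * (a - z i)) s = -1 / 2 := by
  refine pd_eq_of_hasDerivAt ?_
  have h : (fun τ : ℝ => (1 / 2) * (a - (s + τ • EuclideanSpace.single i (1 : ℝ)) i))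
      = fun τ : ℝ => (1 / 2) * (a - (s i + τ)) := by
    ext τ
    simp
  rw [h]
  convert! (((hasDerivAt_id (0 : ℝ)).const_add (s i)).const_sub a).const_mul (1 / 2) using 1
  norm_num

theorem PolyOn.drift {ι : Type*} {S : Set ι} (a : ℝ) (i : Fin 3) :
    PolyOn S (fun _ (z : State) => (1 / 2) * (a - z i)) :=
  ((PolyOn.const a).sub (PolyOn.coord i)).const_mul _

variable {w x : ℝ → State → ℝ} {t : ℝ}

/-- Integrating `∂ᵢ (w x (a - sᵢ) / 2)` moves the drift from `w` to `x`. -/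
theorem integral_drift (hw : IsC12 T T' (PolyGrowth T T') w) (hx : IsC12 T T' (RapidDecay T T') x)
    (ht : t ∈ Icc T T') (a : ℝ) (i : Fin 3) :
    Integrable (fun s => pd i (w t) s * (x t s * ((1 / 2) * (a - s i)))
      + w t s * pd i (fun z => x t z * ((1 / 2) * (a - z i))) s) ∧
    ∫ s, (pd i (w t) s * (x t s * ((1 / 2) * (a - s i)))
      + w t s * pd i (fun z => x t z * ((1 / 2) * (a - z i))) s) = 0 := by
  have hw' : ∀ t ∈ Icc T T', PDiff i (w t) := fun t ht => .of_contDiff (hw.diff_state t ht)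
  have hx' : ∀ t ∈ Icc T T', PDiff i (x t) := fun t ht => .of_contDiff (hx.diff_state t ht)
  have hb : PDiff i (fun z : State => (1 / 2) * (a - z i)) := .of_contDiff (contDiff_drift a i)
  have hp : ∀ t ∈ Icc T T', ∀ s, pd i (fun z => w t z * (x t z * ((1 / 2) * (a - z i)))) s
      = pd i (w t) s * (x t s * ((1 / 2) * (a - s i)))
      + w t s * pd i (fun z => x t z * ((1 / 2) * (a - z i))) s := fun t ht s =>
    pd_mul (hw' t ht) ((hx' t ht).mul hb) s
  have gw : PolyOn (Icc T T') w := hw.growth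
  have gw' : PolyOn (Icc T T') fun t => pd i (w t) := hw.growth_state i
  have gx : RapidOn (Icc T T') x := hx.growth
  have gx' : RapidOn (Icc T T') fun t => pd i (x t) := hx.growth_state i
  have gd : RapidOn (Icc T T') fun t => pd i (fun z => x t z * ((1 / 2) * (a - z i))) :=
    ((gx'.mul_poly (.drift a i)).add (gx.mul_poly (.const (-1 / 2)))).congr fun t ht s => by
      rw [pd_mul (hx' t ht) hb, pd_drift]
  have := integral_pd_eq_zero_of_rapid (i := i)
    (p := fun t z => w t z * (x t z * ((1 / 2) * (a - z i)))) ht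
    ((hw' t ht).mul ((hx' t ht).mul hb))
    ((hw.diff_state t ht).continuous.mul ((hx.diff_state t ht).continuous.mul
      (contDiff_drift a i).continuous)).measurable
    (gw.mul_rapid (gx.mul_poly (.drift a i)))
    (((gw'.mul_rapid (gx.mul_poly (.drift a i))).add (gw.mul_rapid gd)).congr hp)
  simpa only [← hp t ht] using this

/-- Green's identity in one coordinate. -/
theorem integral_green (hw : IsC12 T T' (PolyGrowth T T') w)
    (hx : IsC12 T T' (RapidDecay T T') x) (ht : t ∈ Icc T T') {i : Fin 3}
    (hw₂ : ∀ t ∈ Icc T T', ContDiff ℝ 1 (pd i (w t)))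
    (hx₂ : ∀ t ∈ Icc T T', ContDiff ℝ 1 (pd i (x t)))
    (gw₂ : PolyGrowth T T' fun t => pd i (pd i (w t)))
    (gx₂ : RapidDecay T T' fun t => pd i (pd i (x t))) :
    Integrable (fun s => w t s * pd i (pd i (x t)) s - pd i (pd i (w t)) s * x t s) ∧
    ∫ s, (w t s * pd i (pd i (x t)) s - pd i (pd i (w t)) s * x t s) = 0 := by
  have hw' : ∀ t ∈ Icc T T', PDiff i (w t) := fun t ht => .of_contDiff (hw.diff_state t ht)
  have hx' : ∀ t ∈ Icc T T', PDiff i (x t) := fun t ht => .of_contDiff (hx.diff_state t ht)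
  have dw : ∀ t ∈ Icc T T', PDiff i (pd i (w t)) := fun t ht => .of_contDiff (hw₂ t ht)
  have dx : ∀ t ∈ Icc T T', PDiff i (pd i (x t)) := fun t ht => .of_contDiff (hx₂ t ht)
  have hp : ∀ t ∈ Icc T T', ∀ s, pd i (fun z => w t z * pd i (x t) z - pd i (w t) z * x t z) s
      = w t s * pd i (pd i (x t)) s - pd i (pd i (w t)) s * x t s := fun t ht s => by
    rw [pd_sub ((hw' t ht).mul (dx t ht)) ((dw t ht).mul (hx' t ht)), pd_mul (hw' t ht) (dx t ht),
      pd_mul (dw t ht) (hx' t ht)]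
    ring
  have gw : PolyOn (Icc T T') w := hw.growth
  have gw' : PolyOn (Icc T T') fun t => pd i (w t) := hw.growth_state i
  have gx : RapidOn (Icc T T') x := hx.growth
  have gx' : RapidOn (Icc T T') fun t => pd i (x t) := hx.growth_state i
  have gw₂ : PolyOn (Icc T T') fun t => pd i (pd i (w t)) := gw₂
  have gx₂ : RapidOn (Icc T T') fun t => pd i (pd i (x t)) := gx₂
  have := integral_pd_eq_zero_of_rapid (i := i)
    (p := fun t z => w t z * pd i (x t) z - pd i (w t) z * x t z) ht
    (((hw' t ht).mul (dx t ht)).sub ((dw t ht).mul (hx' t ht)))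
    (((hw.diff_state t ht).continuous.mul (hx₂ t ht).continuous).sub
      ((hw₂ t ht).continuous.mul (hx.diff_state t ht).continuous)).measurable
    ((gw.mul_rapid gx').sub (gw'.mul_rapid gx))
    (((gw.mul_rapid gx₂).sub (gw₂.mul_rapid gx)).congr hp)
  simpa only [← hp t ht] using this

/-- Terms with vanishing integral may be dropped, in the arrangement that the duality pairing
produces. -/
theorem integral_add_null {k a b₁ b₂ d₁ d₂ : State → ℝ} (hk : Integrable k) (ha : Integrable a)
    (hb₁ : Integrable b₁) (hb₂ : Integrable b₂) (hd₁ : Integrable d₁) (hd₂ : Integrable d₂)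
    (ea : ∫ s, a s = 0) (eb₁ : ∫ s, b₁ s = 0) (eb₂ : ∫ s, b₂ s = 0) (ed₁ : ∫ s, d₁ s = 0)
    (ed₂ : ∫ s, d₂ s = 0) (c : ℝ) :
    ∫ s, (k s - a s - (b₁ s + b₂ s) + c * (d₁ s + d₂ s)) = ∫ s, k s := by
  have h1 : Integrable fun s => k s - a s := hk.sub ha
  have h2 : Integrable fun s => b₁ s + b₂ s := hb₁.add hb₂
  have h3 : Integrable fun s => k s - a s - (b₁ s + b₂ s) := h1.sub h2
  have h4 : Integrable fun s => d₁ s + d₂ s := hd₁.add hd₂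
  rw [integral_add h3 (h4.const_mul c), integral_sub h1 h2, integral_sub hk ha,
    integral_add hb₁ hb₂, integral_const_mul, integral_add hd₁ hd₂, ea, eb₁, eb₂, ed₁, ed₂]
  ring

/-- The drift and the diffusion cancel in `d/dt ∫ w x`, because the two equations are adjoint to
each other; only the Hamiltonian terms remain. -/
theorem integral_timeDeriv_eq (hw : IsC12 T T' (PolyGrowth T T') w)
    (hx : IsC12 T T' (RapidDecay T T') x) (ht : t ∈ Icc T T') {μ : Fin 2 → ℝ} {c : ℝ}
    {F K : State → ℝ} (hF : PDiff 0 F) (hFm : Measurable F)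
    (hFr : RapidOn (univ : Set Unit) fun _ => F)
    (hFr' : RapidOn (univ : Set Unit) fun _ => pd 0 F)
    (hK : Integrable fun s => pd 0 (w t) s * F s - K s * x t s)
    (hweq : ∀ s, timeDeriv T T' w t s
      = -K s - (1 / 2) * driftH μ (w t) s - c * lapH (w t) s)
    (hxeq : ∀ s, timeDeriv T T' x t s
      = -pd 0 F s - divDriftH μ (x t) s + c * lapH (x t) s) :
    ∫ s, (timeDeriv T T' w t s * x t s + w t s * timeDeriv T T' x t s)
      = ∫ s, (pd 0 (w t) s * F s - K s * x t s) := by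
  have hw' : PDiff 0 (w t) := .of_contDiff (hw.diff_state t ht)
  have gw : PolyOn (univ : Set Unit) fun _ => w t := PolyOn.fix hw.growth ht _
  have gw' : PolyOn (univ : Set Unit) fun _ => pd 0 (w t) :=
    PolyOn.fix (f := fun t => pd 0 (w t)) (hw.growth_state 0) ht _
  obtain ⟨i0, e0⟩ := integral_pd_eq_zero_of_rapid (S := (univ : Set Unit)) (i := 0)
    (p := fun _ z => w t z * F z) (mem_univ ()) (hw'.mul hF)
    ((hw.diff_state t ht).continuous.measurable.mul hFm) (gw.mul_rapid hFr)
    (((gw'.mul_rapid hFr).add (gw.mul_rapid hFr')).congr fun _ _ s => pd_mul hw' hF s)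
  obtain ⟨i1, e1⟩ := integral_drift hw hx ht (μ 0) 1
  obtain ⟨i2, e2⟩ := integral_drift hw hx ht (μ 1) 2
  obtain ⟨j1, d1⟩ := integral_green hw hx ht hw.diff_state_one hx.diff_state_one
    hw.growth_one_one hx.growth_one_one
  obtain ⟨j2, d2⟩ := integral_green hw hx ht hw.diff_state_two hx.diff_state_two
    hw.growth_two_two hx.growth_two_two
  have hval : ∀ s, timeDeriv T T' w t s * x t s + w t s * timeDeriv T T' x t s
      = (((pd 0 (w t) s * F s - K s * x t s) - pd 0 (fun z => w t z * F z) s)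
        - ((pd 1 (w t) s * (x t s * ((1 / 2) * (μ 0 - s 1)))
            + w t s * pd 1 (fun z => x t z * ((1 / 2) * (μ 0 - z 1))) s)
          + (pd 2 (w t) s * (x t s * ((1 / 2) * (μ 1 - s 2)))
            + w t s * pd 2 (fun z => x t z * ((1 / 2) * (μ 1 - z 2))) s)))
        + c * ((w t s * pd 1 (pd 1 (x t)) s - pd 1 (pd 1 (w t)) s * x t s)
          + (w t s * pd 2 (pd 2 (x t)) s - pd 2 (pd 2 (w t)) s * x t s)) := by
    intro s
    rw [hweq, hxeq, pd_mul hw' hF]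
    simp only [driftH, divDriftH, lapH]
    ring
  simp only [hval]
  exact integral_add_null hK i0 i1 i2 j1 j2 e0 e1 e2 d1 d2 c

theorem hasDerivAt_integral_mul (hT : T ≤ T') (hw : IsC12 T T' (PolyGrowth T T') w)
    (hx : IsC12 T T' (RapidDecay T T') x) :
    ContinuousOn (fun t => ∫ s, w t s * x t s) (Icc T T') ∧
    ∀ t ∈ Ioo T T', HasDerivAt (fun t => ∫ s, w t s * x t s)
      (∫ s, (timeDeriv T T' w t s * x t s + w t s * timeDeriv T T' x t s)) t := by
  have gw : PolyOn (Icc T T') w := hw.growth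
  have gx : RapidOn (Icc T T') x := hx.growth
  have gw' : PolyOn (Icc T T') (timeDeriv T T' w) := hw.growth_time
  have gx' : RapidOn (Icc T T') (timeDeriv T T' x) := hx.growth_time
  have hd : ∀ {f : ℝ → State → ℝ} {t : ℝ} {s : State}, t ∈ Ioo T T' →
      DifferentiableWithinAt ℝ (fun τ => f τ s) (Icc T T') t →
      HasDerivAt (fun τ => f τ s) (timeDeriv T T' f t s) t := fun ht h =>
    h.hasDerivWithinAt.hasDerivAt (Icc_mem_nhds ht.1 ht.2)
  obtain ⟨-, h1, h2⟩ := hasDerivAt_integral_of_rapid (a := T) (b := T')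
    (F := fun t s => w t s * x t s)
    (F' := fun t s => timeDeriv T T' w t s * x t s + w t s * timeDeriv T T' x t s)
    (fun t ht => ((hw.diff_state t ht).continuous.mul (hx.diff_state t ht).continuous).measurable)
    ((gw.mul_rapid gx).fix (left_mem_Icc.2 hT) _)
    ((gw'.mul_rapid gx).add (gw.mul_rapid gx'))
    (fun s t ht => (hw.diff_time t ht s).continuousWithinAt.mul
      (hx.diff_time t ht s).continuousWithinAt)
    (fun s t ht => (hd ht (hw.diff_time t (Ioo_subset_Icc_self ht) s)).mul
      (hd ht (hx.diff_time t (Ioo_subset_Icc_self ht) s)))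
  exact ⟨h1, fun t ht => (h2 t ht).2⟩

end energy

/-! ### A maximum principle -/

theorem deriv_deriv_nonpos_of_isLocalMax {f : ℝ → ℝ} {a : ℝ} (h : IsLocalMax f a)
    (hc : ContinuousAt f a) : deriv (deriv f) a ≤ 0 := by
  by_contra! hpos
  -- a positive second derivative makes `a` also a local minimum, so that `f` is locally constant
  have hmin := isLocalMin_of_deriv_deriv_pos hpos h.deriv_eq_zero hc
  have hconst : f =ᶠ[𝓝 a] fun _ => f a := by
    filter_upwards [h, hmin] with x h1 h2 using le_antisymm h1 h2
  have h2 := hconst.deriv.deriv_eq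
  simp at h2
  linarith

theorem pd_pd_nonpos_of_forall_le {i : Fin 3} {p : State → ℝ} {s : State} (hp : PDiff i p)
    (hmax : ∀ z, p z ≤ p s) : pd i p s = 0 ∧ pd i (pd i p) s ≤ 0 := by
  set e : State := EuclideanSpace.single i (1 : ℝ)
  have hd : ∀ τ : ℝ, HasDerivAt (fun σ : ℝ => p (s + σ • e)) (pd i p (s + τ • e)) τ := by
    intro τ
    have h1 := hp.hasDerivAt (s + τ • e)
    have h2 : HasDerivAt (fun σ : ℝ => σ - τ) 1 τ := (hasDerivAt_id τ).sub_const τ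
    rw [← sub_self τ] at h1
    have h3 := h1.comp (h := fun σ : ℝ => σ - τ) τ h2
    convert! h3 using 1
    · ext σ
      simp only [Function.comp_def, e]
      congr 1
      module
    · simp
  have hloc : IsLocalMax (fun σ : ℝ => p (s + σ • e)) 0 :=
    Eventually.of_forall fun σ => by simpa using hmax (s + σ • e)
  have hderiv : deriv (fun σ : ℝ => p (s + σ • e)) = fun τ => pd i p (s + τ • e) :=
    funext fun τ => (hd τ).deriv
  have h0 := hloc.deriv_eq_zero
  have h2 := deriv_deriv_nonpos_of_isLocalMax hloc (hd 0).continuousAt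
  rw [hderiv] at h0 h2
  exact ⟨by simpa using h0, h2⟩

section barrier

variable (A : ℝ) (k : ℕ) (i : Fin 3)

theorem norm_sq_add_single (s : State) (τ : ℝ) :
    ‖s + τ • EuclideanSpace.single i (1 : ℝ)‖ ^ 2 = ‖s‖ ^ 2 + 2 * τ * s i + τ ^ 2 := by
  rw [norm_add_sq_real, norm_smul, inner_smul_right]
  simp [EuclideanSpace.inner_single_right]
  ring

theorem hasDerivAt_one_add_norm_sq (s : State) :
    HasDerivAt (fun τ : ℝ => 1 + ‖s + τ • EuclideanSpace.single i (1 : ℝ)‖ ^ 2) (2 * s i) 0 := by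
  simp only [norm_sq_add_single]
  have h1 := ((hasDerivAt_id (0 : ℝ)).const_mul 2).mul_const (s i)
  have h2 := ((h1.const_add (‖s‖ ^ 2)).add ((hasDerivAt_id (0 : ℝ)).pow 2)).const_add 1
  convert! h2 using 1
  simp

theorem contDiff_one_add_norm_sq_pow :
    ContDiff ℝ 1 (fun s : State => A * (1 + ‖s‖ ^ 2) ^ k) :=
  contDiff_const.mul ((contDiff_const.add (contDiff_norm_sq ℝ)).pow k)

theorem pd_one_add_norm_sq_pow :
    pd i (fun s : State => A * (1 + ‖s‖ ^ 2) ^ (k + 1))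
      = fun s => A * (((k : ℝ) + 1) * (1 + ‖s‖ ^ 2) ^ k * (2 * s i)) := by
  ext s
  refine pd_eq_of_hasDerivAt ?_
  convert! ((hasDerivAt_one_add_norm_sq i s).pow (k + 1)).const_mul A using 1
  simp

theorem contDiff_pd_one_add_norm_sq_pow :
    ContDiff ℝ 1 (fun s : State => A * (((k : ℝ) + 1) * (1 + ‖s‖ ^ 2) ^ k * (2 * s i))) :=
  contDiff_const.mul ((contDiff_const.mul
    ((contDiff_const.add (contDiff_norm_sq ℝ)).pow k)).mul (contDiff_const.mul (by fun_prop)))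

theorem pd_pd_one_add_norm_sq_pow (s : State) :
    pd i (pd i (fun s : State => A * (1 + ‖s‖ ^ 2) ^ (k + 2))) s
      = A * (((k : ℝ) + 2) * (((k : ℝ) + 1) * (1 + ‖s‖ ^ 2) ^ k * (2 * s i) * (2 * s i)
        + (1 + ‖s‖ ^ 2) ^ (k + 1) * 2)) := by
  rw [pd_one_add_norm_sq_pow A (k + 1) i]
  refine pd_eq_of_hasDerivAt ?_
  have hc : HasDerivAt (fun τ : ℝ => 2 * (s + τ • EuclideanSpace.single i (1 : ℝ)) i) 2 0 := by
    have h : (fun τ : ℝ => 2 * (s + τ • EuclideanSpace.single i (1 : ℝ)) i)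
        = fun τ : ℝ => 2 * (s i + τ) := by
      ext τ
      simp
    rw [h]
    simpa using ((hasDerivAt_id (0 : ℝ)).const_add (s i)).const_mul 2
  have hpow := ((hasDerivAt_one_add_norm_sq i s).pow (k + 1)).const_mul (((k + 1 : ℕ) : ℝ) + 1)
  convert! (hpow.mul hc).const_mul A using 1
  simp only [zero_smul, add_zero, add_tsub_cancel_right, Pi.pow_apply]
  push_cast
  ring

end barrier

variable {T T' : ℝ} {w : ℝ → State → ℝ}

theorem continuousOn_uncurry (hw : IsC12 T T' (PolyGrowth T T') w) :
    ContinuousOn (fun z : ℝ × State => w z.1 z.2) (Icc T T' ×ˢ univ) := by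
  obtain ⟨C, k, hC⟩ := hw.growth_time
  rintro ⟨t, s⟩ ⟨ht, -⟩
  have hlip : ∀ z ∈ (Icc T T' ×ˢ univ : Set (ℝ × State)),
      ‖w z.1 z.2 - w t z.2‖ ≤ C * (1 + ‖z.2‖) ^ k * ‖z.1 - t‖ := fun z hz =>
    (convex_Icc T T').norm_image_sub_le_of_norm_derivWithin_le
      (f := fun τ => w τ z.2) (fun τ hτ => hw.diff_time τ hτ z.2)
      (fun τ hτ => hC τ hτ z.2) ht hz.1
  have h1 : Tendsto (fun z : ℝ × State => w z.1 z.2 - w t z.2) (𝓝[Icc T T' ×ˢ univ] (t, s))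
      (𝓝 0) := by
    refine squeeze_zero_norm' (a := fun z : ℝ × State => C * (1 + ‖z.2‖) ^ k * ‖z.1 - t‖) ?_ ?_
    · filter_upwards [self_mem_nhdsWithin] with z hz using hlip z hz
    · have : Continuous fun z : ℝ × State => C * (1 + ‖z.2‖) ^ k * ‖z.1 - t‖ := by fun_prop
      simpa using (this.tendsto (t, s)).mono_left nhdsWithin_le_nhds
  have h2 : Tendsto (fun z : ℝ × State => w t z.2) (𝓝[Icc T T' ×ˢ univ] (t, s))
      (𝓝 (w t s)) :=
    (((hw.diff_state t ht).continuous.comp continuous_snd).tendsto (t, s)).mono_left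
      nhdsWithin_le_nhds
  simpa [ContinuousWithinAt] using h1.add h2

/-- A high power of `1 + ‖s‖²` dominates polynomial growth far out, so that subtracting a multiple
of it makes the maximum over the states be attained. -/
theorem exists_isMax (hw : IsC12 T T' (PolyGrowth T T') w) :
    ∃ k : ℕ, ∀ (K ε : ℝ), 0 ≤ K → 0 < ε → ∀ t₁ ∈ Icc T T', ∀ s₁,
      0 < w t₁ s₁ - ε * Real.exp (K * (T' - t₁)) * (1 + ‖s₁‖ ^ 2) ^ (k + 2) →
      ∃ t₀ ∈ Icc T T', ∃ s₀,
        0 < w t₀ s₀ - ε * Real.exp (K * (T' - t₀)) * (1 + ‖s₀‖ ^ 2) ^ (k + 2) ∧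
        ∀ t ∈ Icc T T', ∀ s, w t s - ε * Real.exp (K * (T' - t)) * (1 + ‖s‖ ^ 2) ^ (k + 2)
          ≤ w t₀ s₀ - ε * Real.exp (K * (T' - t₀)) * (1 + ‖s₀‖ ^ 2) ^ (k + 2) := by
  obtain ⟨C, k, hC0, hC⟩ := PolyOn.exists_nonneg (S := Icc T T') hw.growth
  refine ⟨k, fun K ε hK hε t₁ ht₁ s₁ hpos => ?_⟩
  set f : ℝ × State → ℝ := fun z =>
    w z.1 z.2 - ε * Real.exp (K * (T' - z.1)) * (1 + ‖z.2‖ ^ 2) ^ (k + 2)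
  set R : ℝ := max ‖s₁‖ (C * 2 ^ (k + 2) / ε)
  have hfc : ContinuousOn f (Icc T T' ×ˢ univ) := by
    refine (continuousOn_uncurry hw).sub (Continuous.continuousOn ?_)
    fun_prop
  have hcomp : IsCompact (Icc T T' ×ˢ Metric.closedBall (0 : State) R) :=
    isCompact_Icc.prod (isCompact_closedBall 0 R)
  have hmem : (t₁, s₁) ∈ Icc T T' ×ˢ Metric.closedBall (0 : State) R :=
    ⟨ht₁, by simp [R]⟩
  obtain ⟨⟨t₀, s₀⟩, ⟨ht₀, -⟩, hmax⟩ := hcomp.exists_isMaxOn ⟨_, hmem⟩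
    (hfc.mono (prod_mono_right (subset_univ _)))
  have hpos₀ : 0 < f (t₀, s₀) := hpos.trans_le (hmax hmem)
  refine ⟨t₀, ht₀, s₀, hpos₀, fun t ht s => ?_⟩
  by_cases hs : s ∈ Metric.closedBall (0 : State) R
  · exact hmax (show (t, s) ∈ _ from ⟨ht, hs⟩)
  · refine le_trans ?_ hpos₀.le
    have hsR : C * 2 ^ (k + 2) / ε < ‖s‖ := by
      simp only [Metric.mem_closedBall, dist_zero_right, not_le] at hs
      exact (le_max_right _ _).trans_lt hs
    rw [div_lt_iff₀ hε] at hsR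
    have h1 := one_le_one_add_norm s
    have h2 : (1 + ‖s‖) ^ 2 ≤ 2 * (1 + ‖s‖ ^ 2) := by nlinarith [sq_nonneg (1 - ‖s‖)]
    have h3 : (1 + ‖s‖) ^ (k + 1) ≤ 2 ^ (k + 2) * (1 + ‖s‖ ^ 2) ^ (k + 2) := by
      calc (1 + ‖s‖) ^ (k + 1) ≤ (1 + ‖s‖) ^ (2 * (k + 2)) := pow_le_pow_right₀ h1 (by omega)
        _ = ((1 + ‖s‖) ^ 2) ^ (k + 2) := by rw [pow_mul]
        _ ≤ (2 * (1 + ‖s‖ ^ 2)) ^ (k + 2) := by gcongr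
        _ = _ := mul_pow _ _ _
    have h4 : 1 ≤ Real.exp (K * (T' - t)) :=
      Real.one_le_exp (mul_nonneg hK (sub_nonneg.2 ht.2))
    have h5 : C * (1 + ‖s‖) ^ k ≤ ε * (1 + ‖s‖ ^ 2) ^ (k + 2) := by
      have e1 : C * (1 + ‖s‖) ^ (k + 1)
          ≤ C * 2 ^ (k + 2) * (1 + ‖s‖ ^ 2) ^ (k + 2) := by
        rw [mul_assoc]
        gcongr
      have e2 : C * 2 ^ (k + 2) * (1 + ‖s‖ ^ 2) ^ (k + 2)
          ≤ (1 + ‖s‖) * ε * (1 + ‖s‖ ^ 2) ^ (k + 2) := by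
        refine mul_le_mul_of_nonneg_right ?_ (by positivity)
        linarith
      have e3 : (1 + ‖s‖) * (C * (1 + ‖s‖) ^ k)
          ≤ (1 + ‖s‖) * (ε * (1 + ‖s‖ ^ 2) ^ (k + 2)) := by
        calc _ = C * (1 + ‖s‖) ^ (k + 1) := by ring
          _ ≤ _ := e1.trans e2
          _ = _ := by ring
      exact le_of_mul_le_mul_left e3 (by linarith)
    have h6 : ε * (1 + ‖s‖ ^ 2) ^ (k + 2)
        ≤ ε * Real.exp (K * (T' - t)) * (1 + ‖s‖ ^ 2) ^ (k + 2) := by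
      exact mul_le_mul_of_nonneg_right (le_mul_of_one_le_right hε.le h4) (by positivity)
    have h7 := (le_abs_self _).trans (hC t ht s)
    linarith

theorem abs_coord_le_one_add_norm_sq (s : State) (i : Fin 3) : |s i| ≤ 1 + ‖s‖ ^ 2 := by
  have := abs_coord_le s i
  nlinarith [sq_nonneg (‖s‖ - 1), sq_nonneg ‖s‖]

theorem coord_sq_le (s : State) (i : Fin 3) : s i ^ 2 ≤ 1 + ‖s‖ ^ 2 := by
  have := sq_le_sq' (by linarith [abs_coord_le s i, neg_abs_le (s i)])
    ((le_abs_self _).trans (abs_coord_le s i))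
  linarith

/-- `e^{K (T' - t)} (1 + ‖s‖²)^{k+2}` is a strict supersolution once `K` is large: the operator
without its time derivative increases the barrier at most by a constant factor. -/
theorem barrier_lt (μ : Fin 2 → ℝ) {c P A : ℝ} (hc : 0 ≤ c) (hP : 0 ≤ P) (hA : 0 < A) (k : ℕ)
    (s : State) :
    (1 / 2) * driftH μ (fun s => A * (1 + ‖s‖ ^ 2) ^ (k + 2)) s
      + c * lapH (fun s => A * (1 + ‖s‖ ^ 2) ^ (k + 2)) s
      + P * |pd 0 (fun s => A * (1 + ‖s‖ ^ 2) ^ (k + 2)) s|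
    < (((k : ℝ) + 2) * (|μ 0| + |μ 1| + 2 * P + c * (8 * k + 12)) + 1)
      * (A * (1 + ‖s‖ ^ 2) ^ (k + 2)) := by
  simp only [driftH, lapH, pd_pd_one_add_norm_sq_pow]
  simp only [pd_one_add_norm_sq_pow A (k + 1)]
  push_cast
  have hρ : 1 ≤ 1 + ‖s‖ ^ 2 := by nlinarith [sq_nonneg ‖s‖]
  have a0 := abs_coord_le_one_add_norm_sq s 0
  have a1 := abs_coord_le_one_add_norm_sq s 1
  have a2 := abs_coord_le_one_add_norm_sq s 2
  have b1 := coord_sq_le s 1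
  have b2 := coord_sq_le s 2
  generalize 1 + ‖s‖ ^ 2 = ρ at *
  have hρ0 : 0 < ρ := by linarith
  have hk : (0 : ℝ) ≤ k := Nat.cast_nonneg k
  have d : ∀ (m x : ℝ), |x| ≤ ρ → (m - x) * x ≤ |m| * ρ := by
    intro m x hx
    have h1 : m * x ≤ |m| * |x| := (le_abs_self _).trans (abs_mul _ _).le
    have h2 : |m| * |x| ≤ |m| * ρ := by gcongr
    nlinarith [sq_nonneg x]
  have d1 := d (μ 0) (s 1) a1
  have d2 := d (μ 1) (s 2) a2
  have habs : |A * (((k : ℝ) + 1 + 1) * ρ ^ (k + 1) * (2 * s 0))|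
      = A * ((k : ℝ) + 2) * ρ ^ (k + 1) * 2 * |s 0| := by
    rw [abs_mul, abs_mul, abs_mul, abs_mul, abs_of_pos hA,
      abs_of_pos (by positivity : 0 < ρ ^ (k + 1)),
      abs_of_pos (by positivity : (0 : ℝ) < (k : ℝ) + 1 + 1), abs_two]
    ring
  rw [habs]
  have hB : 0 < A * ((k : ℝ) + 2) * ρ ^ (k + 1) := by positivity
  have hB' : 0 ≤ A * ((k : ℝ) + 2) * ((k : ℝ) + 1) * ρ ^ k * c := by positivity
  have t1 := mul_le_mul_of_nonneg_left (add_le_add d1 d2) hB.le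
  have t2 := mul_le_mul_of_nonneg_left a0 (mul_nonneg hB.le hP)
  have t3 := mul_le_mul_of_nonneg_left (add_le_add b1 b2) hB'
  have hB'' : 0 ≤ A * ((k : ℝ) + 2) * ρ ^ (k + 1) * c * (8 * k + 12) := by positivity
  have t4 := mul_le_mul_of_nonneg_left hρ hB''
  have t5 : 0 < A * ρ ^ (k + 2) := by positivity
  have r1 : ρ ^ (k + 1) = ρ ^ k * ρ := pow_succ _ _
  have r2 : ρ ^ (k + 2) = ρ ^ k * ρ * ρ := by ring
  rw [r2] at t5 ⊢
  rw [r1] at t1 t2 t4 ⊢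
  linarith

/-- Maximum principle: a subsolution of polynomial growth that vanishes at the final time is
nonpositive. There is no diffusion in `E`, and the gradient in `E` enters only through a bounded
coefficient. -/
theorem nonpos_of_subsolution (hw : IsC12 T T' (PolyGrowth T T') w) (hfin : ∀ s, w T' s = 0)
    {μ : Fin 2 → ℝ} {c P : ℝ} (hc : 0 ≤ c) (hP : 0 ≤ P)
    (hsub : ∀ t ∈ Icc T T', ∀ s, 0 ≤ timeDeriv T T' w t s + (1 / 2) * driftH μ (w t) s
      + c * lapH (w t) s + P * |pd 0 (w t) s|)
    {t : ℝ} (ht : t ∈ Icc T T') (s : State) : w t s ≤ 0 := by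
  by_contra! hpos
  obtain ⟨k, hmax⟩ := exists_isMax hw
  set K : ℝ := ((k : ℝ) + 2) * (|μ 0| + |μ 1| + 2 * P + c * (8 * k + 12)) + 1 with hKdef
  have hK : 0 ≤ K := by positivity
  set B : ℝ := Real.exp (K * (T' - t)) * (1 + ‖s‖ ^ 2) ^ (k + 2) with hBdef
  have hB : 0 < B := by positivity
  have hε : 0 < w t s / (2 * B) := by positivity
  set ε : ℝ := w t s / (2 * B) with hεdef
  obtain ⟨t₀, ht₀, s₀, hpos₀, hle⟩ := hmax K ε hK hε t ht s (by
    rw [mul_assoc, ← hBdef, hεdef]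
    have : w t s / (2 * B) * B = w t s / 2 := by field_simp
    rw [this]
    linarith)
  set A : ℝ := ε * Real.exp (K * (T' - t₀)) with hAdef
  have hA : 0 < A := by positivity
  have hlt : t₀ < T' := by
    refine lt_of_le_of_ne ht₀.2 fun h => ?_
    have h0 : w t₀ s₀ = 0 := by rw [h, hfin]
    have : 0 < A * (1 + ‖s₀‖ ^ 2) ^ (k + 2) := by positivity
    linarith
  have htime : timeDeriv T T' w t₀ s₀ ≤ -K * (A * (1 + ‖s₀‖ ^ 2) ^ (k + 2)) := by
    have h1 : HasDerivWithinAt (fun τ => w τ s₀) (timeDeriv T T' w t₀ s₀) (Icc T T') t₀ :=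
      (hw.diff_time t₀ ht₀ s₀).hasDerivWithinAt
    have h2 : HasDerivAt (fun τ => ε * Real.exp (K * (T' - τ)) * (1 + ‖s₀‖ ^ 2) ^ (k + 2))
        (-K * (A * (1 + ‖s₀‖ ^ 2) ^ (k + 2))) t₀ := by
      have := ((((hasDerivAt_id t₀).const_sub T').const_mul K).exp.const_mul ε).mul_const
        ((1 + ‖s₀‖ ^ 2) ^ (k + 2))
      convert! this using 1
      simp [hAdef]
      ring
    have h3 := h1.sub h2.hasDerivWithinAt
    have hloc : IsLocalMaxOn (fun τ => w τ s₀
        - ε * Real.exp (K * (T' - τ)) * (1 + ‖s₀‖ ^ 2) ^ (k + 2)) (Icc T T') t₀ := by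
      filter_upwards [self_mem_nhdsWithin] with τ hτ using hle τ hτ s₀
    have h4 := hloc.hasFDerivWithinAt_nonpos h3.hasFDerivWithinAt
      (sub_mem_posTangentConeAt_of_segment_subset
        ((convex_Icc T T').segment_subset ht₀ (right_mem_Icc.2 (ht₀.1.trans ht₀.2))))
    have h5 : 0 < T' - t₀ := sub_pos.2 hlt
    simp only [ContinuousLinearMap.toSpanSingleton_apply, smul_eq_mul] at h4
    nlinarith
  have hcd := contDiff_one_add_norm_sq_pow A (k + 2)
  have hcd' : ∀ i, ContDiff ℝ 1 (pd i fun s : State => A * (1 + ‖s‖ ^ 2) ^ (k + 2)) := fun i => by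
    rw [pd_one_add_norm_sq_pow A (k + 1) i]
    exact contDiff_pd_one_add_norm_sq_pow A (k + 1) i
  have hw' : ∀ i, PDiff i (w t₀) := fun i => .of_contDiff (hw.diff_state t₀ ht₀)
  have hpdsub : ∀ i, pd i (fun s => w t₀ s - A * (1 + ‖s‖ ^ 2) ^ (k + 2))
      = fun s => pd i (w t₀) s - pd i (fun s => A * (1 + ‖s‖ ^ 2) ^ (k + 2)) s := fun i =>
    funext fun s => pd_sub (hw' i) (.of_contDiff hcd) s
  have hspace : ∀ i, pd i (fun s => w t₀ s - A * (1 + ‖s‖ ^ 2) ^ (k + 2)) s₀ = 0 ∧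
      pd i (pd i (fun s => w t₀ s - A * (1 + ‖s‖ ^ 2) ^ (k + 2))) s₀ ≤ 0 := fun i =>
    pd_pd_nonpos_of_forall_le ((hw' i).sub (.of_contDiff hcd)) fun z => hle t₀ ht₀ z
  have hgrad : ∀ i, pd i (w t₀) s₀ = pd i (fun s => A * (1 + ‖s‖ ^ 2) ^ (k + 2)) s₀ := fun i => by
    have := (hspace i).1
    rw [hpdsub] at this
    linarith
  have hhess : ∀ i, PDiff i (pd i (w t₀)) →
      pd i (pd i (w t₀)) s₀ ≤ pd i (pd i (fun s => A * (1 + ‖s‖ ^ 2) ^ (k + 2))) s₀ := by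
    intro i hi
    have := (hspace i).2
    rw [hpdsub, pd_sub hi (.of_contDiff (hcd' i))] at this
    linarith
  have hb := barrier_lt μ hc hP hA k s₀
  rw [← hKdef] at hb
  have hs := hsub t₀ ht₀ s₀
  have l1 := hhess 1 (.of_contDiff (hw.diff_state_one t₀ ht₀))
  have l2 := hhess 2 (.of_contDiff (hw.diff_state_two t₀ ht₀))
  have l3 := mul_le_mul_of_nonneg_left (add_le_add l1 l2) hc
  simp only [driftH, lapH, hgrad] at hs hb
  linarith

/-! ### Uniqueness -/

theorem IsC12.sub_poly {T T' : ℝ} {f g : ℝ → State → ℝ}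
    (hf : IsC12 T T' (PolyGrowth T T') f) (hg : IsC12 T T' (PolyGrowth T T') g) :
    IsC12 T T' (PolyGrowth T T') fun t s => f t s - g t s :=
  hf.sub (fun _ _ => PolyOn.sub (S := Icc T T')) (fun _ _ => PolyOn.congr (S := Icc T T')) hg

theorem IsC12.sub_rapid {T T' : ℝ} {f g : ℝ → State → ℝ}
    (hf : IsC12 T T' (RapidDecay T T') f) (hg : IsC12 T T' (RapidDecay T T') g) :
    IsC12 T T' (RapidDecay T T') fun t s => f t s - g t s :=
  hf.sub (fun _ _ => RapidOn.sub (S := Icc T T')) (fun _ _ => RapidOn.congr (S := Icc T T')) hg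

section solution

variable {T T' Pmax η : ℝ} {μ : Fin 2 → ℝ} {r : ℝ → State → ℝ → (State → ℝ) → ℝ}
  {q m₀ : State → ℝ} {v m v₁ m₁ v₂ m₂ : ℝ → State → ℝ}

/-- The flux `m_t ∂_{u'}H̃(t, s, ∂_E v_t, m_t)` of the mean field in the direction of `E`. -/
def flux (Pmax : ℝ) (r : ℝ → State → ℝ → (State → ℝ) → ℝ) (v m : ℝ → State → ℝ) (t : ℝ)
    (z : State) : ℝ :=
  m t z * derivU (hamiltonian Pmax (r t)) z (pd 0 (v t) z) (m t)

theorem IsSolution.isProfile (h : IsSolution T T' Pmax η μ r q m₀ v m) {t : ℝ}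
    (ht : t ∈ Icc T T') : IsProfile (pd 0 (v t)) := by
  obtain ⟨C, k, hC⟩ := h.v_reg.growth_state 0
  exact ⟨continuous_pd (h.v_reg.diff_state t ht), C, k, fun s => hC t ht s⟩

/-- The growth of `H̃` itself is not assumed; along a solution it follows from the equation. -/
theorem IsSolution.poly_hamiltonian (h : IsSolution T T' Pmax η μ r q m₀ v m) :
    PolyOn (Icc T T') fun t s => hamiltonian Pmax (r t) s (pd 0 (v t) s) (m t) := by
  have g0 : PolyOn (Icc T T') (timeDeriv T T' v) := h.v_reg.growth_time
  have g1 : PolyOn (Icc T T') fun t => pd 1 (v t) := h.v_reg.growth_state 1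
  have g2 : PolyOn (Icc T T') fun t => pd 2 (v t) := h.v_reg.growth_state 2
  have g11 : PolyOn (Icc T T') fun t => pd 1 (pd 1 (v t)) := h.v_reg.growth_one_one
  have g22 : PolyOn (Icc T T') fun t => pd 2 (pd 2 (v t)) := h.v_reg.growth_two_two
  have hd := ((PolyOn.drift (μ 0) 1).mul g1).add ((PolyOn.drift (μ 1) 2).mul g2)
  refine ((g0.neg.sub hd).sub ((g11.add g22).const_mul (η ^ 2 / 2))).congr fun t ht s => ?_
  have := h.hjb t ht s
  simp only [driftH, lapH] at this
  linarith

theorem IsSolution.pDiff_flux (h : IsSolution T T' Pmax η μ r q m₀ v m) {t : ℝ}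
    (ht : t ∈ Icc T T') : PDiff 0 (flux Pmax r v m t) :=
  h.flux_diff t ht

theorem IsSolution.pd_flux (h : IsSolution T T' Pmax η μ r q m₀ v m) {t : ℝ}
    (ht : t ∈ Icc T T') (s : State) :
    pd 0 (flux Pmax r v m t) s
      = η ^ 2 / 2 * lapH (m t) s - timeDeriv T T' m t s - divDriftH μ (m t) s := by
  have : timeDeriv T T' m t s + pd 0 (flux Pmax r v m t) s + divDriftH μ (m t) s
      = η ^ 2 / 2 * lapH (m t) s := h.fpk t ht s
  linarith

theorem IsSolution.rapid_flux (h : IsSolution T T' Pmax η μ r q m₀ v m) :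
    RapidOn (Icc T T') (flux Pmax r v m) := by
  have g : RapidOn (Icc T T') m := h.m_reg.growth
  exact g.mul_poly ⟨|Pmax|, 0, fun t _ s => by
    simpa using abs_derivU_le Pmax (r t) s (pd 0 (v t) s) (m t)⟩

theorem IsSolution.rapid_pd_flux (h : IsSolution T T' Pmax η μ r q m₀ v m) :
    RapidOn (Icc T T') fun t => pd 0 (flux Pmax r v m t) := by
  have g : RapidOn (Icc T T') m := h.m_reg.growth
  have g0 : RapidOn (Icc T T') (timeDeriv T T' m) := h.m_reg.growth_time
  have g1 : RapidOn (Icc T T') fun t => pd 1 (m t) := h.m_reg.growth_state 1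
  have g2 : RapidOn (Icc T T') fun t => pd 2 (m t) := h.m_reg.growth_state 2
  have g11 : RapidOn (Icc T T') fun t => pd 1 (pd 1 (m t)) := h.m_reg.growth_one_one
  have g22 : RapidOn (Icc T T') fun t => pd 2 (pd 2 (m t)) := h.m_reg.growth_two_two
  have hd : ∀ (a : ℝ) (i : Fin 3), RapidOn (Icc T T') (fun t => pd i (m t)) →
      RapidOn (Icc T T') fun t => pd i (fun z => m t z * ((1 / 2) * (a - z i))) :=
    fun a i gi => ((gi.mul_poly (.drift a i)).add (g.mul_poly (.const (-1 / 2)))).congr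
      fun t ht s => by
        rw [pd_mul (.of_contDiff (h.m_reg.diff_state t ht)) (.of_contDiff (contDiff_drift a i)),
          pd_drift]
  refine ((((PolyOn.const (η ^ 2 / 2)).mul_rapid (g11.add g22)).sub g0).sub
    ((hd (μ 0) 1 g1).add (hd (μ 1) 2 g2))).congr fun t ht s => ?_
  rw [h.pd_flux ht]
  rfl

theorem IsSolution.measurable_flux
    {Hm Hum : State → ℝ → (State → ℝ) → ((State → ℝ) →ₗ[ℝ] ℝ)}
    (h : IsSolution T T' Pmax η μ r q m₀ v m) {t : ℝ} (ht : t ∈ Icc T T')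
    (hreg : RegularHamiltonian (hamiltonian Pmax (r t)) Hm Hum) :
    Measurable (flux Pmax r v m t) :=
  (h.density t ht).cont.measurable.mul ((hreg.measurable_derivU (h.density t ht)).comp
    (measurable_id.prodMk (h.isProfile ht).1.measurable))

theorem driftH_sub {f g : State → ℝ} (hf : ContDiff ℝ 1 f) (hg : ContDiff ℝ 1 g) (s : State) :
    driftH μ (fun s => f s - g s) s = driftH μ f s - driftH μ g s := by
  simp only [driftH, pd_sub (.of_contDiff hf) (.of_contDiff hg)]
  ring

theorem divDriftH_sub {f g : State → ℝ} (hf : ContDiff ℝ 1 f) (hg : ContDiff ℝ 1 g) (s : State) :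
    divDriftH μ (fun s => f s - g s) s = divDriftH μ f s - divDriftH μ g s := by
  have hb : ∀ (a : ℝ) (i : Fin 3), PDiff i (fun z : State => (1 / 2) * (a - z i)) :=
    fun a i => .of_contDiff (contDiff_drift a i)
  have hf' : ∀ i, PDiff i f := fun i => .of_contDiff hf
  have hg' : ∀ i, PDiff i g := fun i => .of_contDiff hg
  simp only [divDriftH]
  rw [pd_mul ((hf' 1).sub (hg' 1)) (hb _ 1), pd_mul ((hf' 2).sub (hg' 2)) (hb _ 2),
    pd_mul (hf' 1) (hb _ 1), pd_mul (hf' 2) (hb _ 2), pd_mul (hg' 1) (hb _ 1),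
    pd_mul (hg' 2) (hb _ 2), pd_sub (hf' 1) (hg' 1), pd_sub (hf' 2) (hg' 2)]
  ring

theorem lapH_sub {f g : State → ℝ} (hf : ContDiff ℝ 1 f) (hg : ContDiff ℝ 1 g)
    (hf₁ : ContDiff ℝ 1 (pd 1 f)) (hg₁ : ContDiff ℝ 1 (pd 1 g))
    (hf₂ : ContDiff ℝ 1 (pd 2 f)) (hg₂ : ContDiff ℝ 1 (pd 2 g)) (s : State) :
    lapH (fun s => f s - g s) s = lapH f s - lapH g s := by
  have h : ∀ i, pd i (fun s => f s - g s) = fun s => pd i f s - pd i g s := fun i =>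
    funext fun s => pd_sub (.of_contDiff hf) (.of_contDiff hg) s
  simp only [lapH, h]
  rw [pd_sub (.of_contDiff hf₁) (.of_contDiff hg₁), pd_sub (.of_contDiff hf₂) (.of_contDiff hg₂)]
  ring

theorem timeDeriv_sub {G : (ℝ → State → ℝ) → Prop} {f g : ℝ → State → ℝ}
    (hf : IsC12 T T' G f) (hg : IsC12 T T' G g) {t : ℝ} (ht : t ∈ Icc T T') (s : State) :
    timeDeriv T T' (fun t s => f t s - g t s) t s = timeDeriv T T' f t s - timeDeriv T T' g t s :=
  derivWithin_fun_sub (hf.diff_time t ht s) (hg.diff_time t ht s)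

theorem IsSolution.timeDeriv_value_sub (h₁ : IsSolution T T' Pmax η μ r q m₀ v₁ m₁)
    (h₂ : IsSolution T T' Pmax η μ r q m₀ v₂ m₂) {t : ℝ} (ht : t ∈ Icc T T') (s : State) :
    timeDeriv T T' (fun t s => v₂ t s - v₁ t s) t s
      = -(hamiltonian Pmax (r t) s (pd 0 (v₂ t) s) (m₂ t)
          - hamiltonian Pmax (r t) s (pd 0 (v₁ t) s) (m₁ t))
        - (1 / 2) * driftH μ (fun s => v₂ t s - v₁ t s) s
        - η ^ 2 / 2 * lapH (fun s => v₂ t s - v₁ t s) s := by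
  have r₁ := h₁.v_reg
  have r₂ := h₂.v_reg
  rw [timeDeriv_sub r₂ r₁ ht, driftH_sub (r₂.diff_state t ht) (r₁.diff_state t ht),
    lapH_sub (r₂.diff_state t ht) (r₁.diff_state t ht) (r₂.diff_state_one t ht)
      (r₁.diff_state_one t ht) (r₂.diff_state_two t ht) (r₁.diff_state_two t ht)]
  linarith [h₁.hjb t ht s, h₂.hjb t ht s]

theorem IsSolution.timeDeriv_density_sub (h₁ : IsSolution T T' Pmax η μ r q m₀ v₁ m₁)
    (h₂ : IsSolution T T' Pmax η μ r q m₀ v₂ m₂) {t : ℝ} (ht : t ∈ Icc T T') (s : State) :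
    timeDeriv T T' (fun t s => m₂ t s - m₁ t s) t s
      = -pd 0 (fun s => flux Pmax r v₂ m₂ t s - flux Pmax r v₁ m₁ t s) s
        - divDriftH μ (fun s => m₂ t s - m₁ t s) s
        + η ^ 2 / 2 * lapH (fun s => m₂ t s - m₁ t s) s := by
  have r₁ := h₁.m_reg
  have r₂ := h₂.m_reg
  rw [timeDeriv_sub r₂ r₁ ht, divDriftH_sub (r₂.diff_state t ht) (r₁.diff_state t ht),
    lapH_sub (r₂.diff_state t ht) (r₁.diff_state t ht) (r₂.diff_state_one t ht)
      (r₁.diff_state_one t ht) (r₂.diff_state_two t ht) (r₁.diff_state_two t ht),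
    pd_sub (h₂.pDiff_flux ht) (h₁.pDiff_flux ht), h₁.pd_flux ht, h₂.pd_flux ht]
  ring

/-- `∫ w x` vanishes at both ends of the horizon and is nondecreasing in between, so that its
derivative is zero, which strict monotonicity allows only for `x = 0`. -/
theorem IsSolution.density_eq (hT : T < T')
    {Hm Hum : ℝ → State → ℝ → (State → ℝ) → ((State → ℝ) →ₗ[ℝ] ℝ)}
    (hreg : ∀ t ∈ Icc T T', RegularHamiltonian (hamiltonian Pmax (r t)) (Hm t) (Hum t))
    (huu : ∀ t ∈ Icc T T', ∀ s u m, IsDensity m → 0 < derivUU (hamiltonian Pmax (r t)) s u m)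
    (hschur : ∀ t ∈ Icc T T', ∀ u m, IsProfile u → IsDensity m →
      PositiveForm m (formSchur (hamiltonian Pmax (r t)) (Hm t) (Hum t) u m))
    (h₁ : IsSolution T T' Pmax η μ r q m₀ v₁ m₁) (h₂ : IsSolution T T' Pmax η μ r q m₀ v₂ m₂)
    {t : ℝ} (ht : t ∈ Icc T T') : m₁ t = m₂ t := by
  have hw := h₂.v_reg.sub_poly h₁.v_reg
  have hx := h₂.m_reg.sub_rapid h₁.m_reg
  obtain ⟨hcont, hder⟩ := hasDerivAt_integral_mul hT.le hw hx
  have key : ∀ t ∈ Icc T T',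
      0 ≤ (∫ s, (timeDeriv T T' (fun t s => v₂ t s - v₁ t s) t s * (m₂ t s - m₁ t s)
        + (v₂ t s - v₁ t s) * timeDeriv T T' (fun t s => m₂ t s - m₁ t s) t s)) ∧
      (m₁ t ≠ m₂ t →
      0 < ∫ s, (timeDeriv T T' (fun t s => v₂ t s - v₁ t s) t s * (m₂ t s - m₁ t s)
        + (v₂ t s - v₁ t s) * timeDeriv T T' (fun t s => m₂ t s - m₁ t s) t s)) := by
    intro t ht
    have hpd : ∀ s, pd 0 (fun s => v₂ t s - v₁ t s) s = pd 0 (v₂ t) s - pd 0 (v₁ t) s :=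
      pd_sub (.of_contDiff (h₂.v_reg.diff_state t ht)) (.of_contDiff (h₁.v_reg.diff_state t ht))
    obtain ⟨hint, hpos⟩ := integral_path_pos (hreg t ht) (abs_derivU_le Pmax (r t)) (huu t ht)
      (hschur t ht) (h₁.isProfile ht) (h₂.isProfile ht) (h₁.density t ht) (h₂.density t ht)
      (h₁.poly_hamiltonian.fix ht _)
    rw [integral_timeDeriv_eq hw hx ht (μ := μ) (c := η ^ 2 / 2)
      (F := fun s => flux Pmax r v₂ m₂ t s - flux Pmax r v₁ m₁ t s)
      (K := fun s => hamiltonian Pmax (r t) s (pd 0 (v₂ t) s) (m₂ t)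
          - hamiltonian Pmax (r t) s (pd 0 (v₁ t) s) (m₁ t))
      ((h₂.pDiff_flux ht).sub (h₁.pDiff_flux ht))
      ((h₂.measurable_flux ht (hreg t ht)).sub (h₁.measurable_flux ht (hreg t ht)))
      ((h₂.rapid_flux.sub h₁.rapid_flux).fix ht _)
      (((h₂.rapid_pd_flux.sub h₁.rapid_pd_flux).fix ht _).congr
        fun _ _ s => pd_sub (h₂.pDiff_flux ht) (h₁.pDiff_flux ht) s)
      (by simpa only [hpd, flux] using hint)
      (h₁.timeDeriv_value_sub h₂ ht) (h₁.timeDeriv_density_sub h₂ ht)]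
    simpa only [hpd, flux] using hpos
  have hmono : MonotoneOn (fun t => ∫ s, (v₂ t s - v₁ t s) * (m₂ t s - m₁ t s)) (Icc T T') :=
    monotoneOn_of_deriv_nonneg (convex_Icc T T') hcont
      (fun t ht => by
        rw [interior_Icc] at ht
        exact (hder t ht).differentiableAt.differentiableWithinAt)
      (fun t ht => by
        rw [interior_Icc] at ht
        rw [(hder t ht).deriv]
        exact (key t (Ioo_subset_Icc_self ht)).1)
  have hzero : ∀ t ∈ Icc T T', ∫ s, (v₂ t s - v₁ t s) * (m₂ t s - m₁ t s) = 0 := by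
    intro t ht
    have a := hmono (left_mem_Icc.2 hT.le) ht ht.1
    have b := hmono ht (right_mem_Icc.2 hT.le) ht.2
    simp only [h₁.initial, h₂.initial, h₁.final, h₂.final, sub_self, mul_zero, zero_mul,
      integral_zero] at a b
    exact le_antisymm b a
  have hinner : ∀ t ∈ Ioo T T', m₁ t = m₂ t := by
    intro t ht
    by_contra hne
    have hpos := (key t (Ioo_subset_Icc_self ht)).2 hne
    have hconst : (fun t => ∫ s, (v₂ t s - v₁ t s) * (m₂ t s - m₁ t s)) =ᶠ[𝓝 t] fun _ => 0 := by
      filter_upwards [Icc_mem_nhds ht.1 ht.2] with τ hτ using hzero τ hτ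
    have := (hder t ht).unique ((hasDerivAt_const t (0 : ℝ)).congr_of_eventuallyEq hconst)
    exact hpos.ne' this
  -- the end points follow by continuity in time
  ext s
  exact EqOn.of_subset_closure (s := Ioo T T') (t := Icc T T')
    (f := fun t => m₁ t s) (g := fun t => m₂ t s)
    (fun t ht => congrFun (hinner t ht) s)
    (fun t ht => (h₁.m_reg.diff_time t ht s).continuousWithinAt)
    (fun t ht => (h₂.m_reg.diff_time t ht s).continuousWithinAt)
    Ioo_subset_Icc_self (closure_Ioo hT.ne).ge ht

/-- With a common mean field the values differ by a subsolution, since `H̃` is Lipschitz in `u'`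
with constant `Pmax`. -/
theorem IsSolution.value_le (h₁ : IsSolution T T' Pmax η μ r q m₀ v₁ m₁)
    (h₂ : IsSolution T T' Pmax η μ r q m₀ v₂ m₂) (hm : ∀ t ∈ Icc T T', m₁ t = m₂ t)
    {t : ℝ} (ht : t ∈ Icc T T') (s : State) : v₂ t s ≤ v₁ t s := by
  have hw := h₂.v_reg.sub_poly h₁.v_reg
  refine sub_nonpos.1 (nonpos_of_subsolution hw (fun s => by rw [h₁.final, h₂.final, sub_self])
    (μ := μ) (c := η ^ 2 / 2) (P := |Pmax|) (by positivity) (abs_nonneg _) (fun t ht s => ?_) ht s)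
  rw [h₁.timeDeriv_value_sub h₂ ht, hm t ht,
    pd_sub (.of_contDiff (h₂.v_reg.diff_state t ht)) (.of_contDiff (h₁.v_reg.diff_state t ht))]
  have := (le_abs_self _).trans (abs_hamiltonian_sub_le Pmax (r t) s (pd 0 (v₂ t) s)
    (pd 0 (v₁ t) s) (m₂ t))
  linarith

end solution

end MeanField
end

theorem proposition4
    (T T' Pmax η : ℝ) (hT : T ≤ T') (μ : Fin 2 → ℝ)
    (r : ℝ → MeanField.State → ℝ → (MeanField.State → ℝ) → ℝ)
    (q m₀ : MeanField.State → ℝ)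
    (Hm Hum : ℝ → MeanField.State → ℝ → (MeanField.State → ℝ) →
      ((MeanField.State → ℝ) →ₗ[ℝ] ℝ))
    (hreg : ∀ t ∈ Set.Icc T T',
      MeanField.RegularHamiltonian (MeanField.hamiltonian Pmax (r t)) (Hm t) (Hum t))
    (h_m : ∀ t ∈ Set.Icc T T', ∀ u m : MeanField.State → ℝ,
      MeanField.IsProfile u → MeanField.IsDensity m →
        MeanField.PositiveForm m (MeanField.formM (Hm t) u m))
    (h_uu : ∀ t ∈ Set.Icc T T', ∀ (s : MeanField.State) (u : ℝ) (m : MeanField.State → ℝ),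
      MeanField.IsDensity m →
        0 < MeanField.derivUU (MeanField.hamiltonian Pmax (r t)) s u m)
    (h_schur : ∀ t ∈ Set.Icc T T', ∀ u m : MeanField.State → ℝ,
      MeanField.IsProfile u → MeanField.IsDensity m →
        MeanField.PositiveForm m
          (MeanField.formSchur (MeanField.hamiltonian Pmax (r t)) (Hm t) (Hum t) u m))
    (v₁ m₁ v₂ m₂ : ℝ → MeanField.State → ℝ)
    (h₁ : MeanField.IsSolution T T' Pmax η μ r q m₀ v₁ m₁)
    (h₂ : MeanField.IsSolution T T' Pmax η μ r q m₀ v₂ m₂) :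
    ∀ t ∈ Set.Icc T T', v₁ t = v₂ t ∧ m₁ t = m₂ t := by
  intro t ht
  rcases hT.eq_or_lt with rfl | hlt
  · obtain rfl : t = T := le_antisymm ht.2 ht.1
    exact ⟨h₁.final.trans h₂.final.symm, h₁.initial.trans h₂.initial.symm⟩
  have hm : ∀ τ ∈ Icc T T', m₁ τ = m₂ τ := fun τ hτ =>
    MeanField.IsSolution.density_eq hlt hreg h_uu h_schur h₁ h₂ hτ
  exact ⟨funext fun s => le_antisymm
    (h₂.value_le h₁ (fun τ hτ => (hm τ hτ).symm) ht s) (h₁.value_le h₂ hm ht s), hm t ht⟩
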